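/- **Theorem 3.** In the problem Shortest Path with Forcing Graph, an instance $I=(G,G_f,s,t,k)$ consists of a finite simple undirected graph $G=(V,E)$, a simple undirected graph $G_f=(E,E')$ (the forcing graph, whose vertex set is the edge set of $G$), two distinct vertices $s,t\in V$ and a positive integer $k$, which is the parameter. $I$ is a yes-instance if there is a set $E^*\subseteq E$ with $|E^*|\le k$ such that the graph $(V,E^*)$ contains an $s$-$t$ path and $E^*$ is a vertex cover of $G_f$. Let $|I|$ be $|V|+|E|+|E'|$ plus the number of binary digits of $k$. Shortest Path with Forcing Graph, for arbitrary $G$ and $G_f$, admits a polynomial kernel with $O(k^5)$ vertices and edges. That is, there are a deterministic algorithm, polynomials $p$, $g$ and a constant $C$ such that the algorithm, given any instance $I=(G,G_f,s,t,k)$, outputs after at most $p(|I|)$ steps an instance $I'=(G',G'_f,s',t',k')$ which is a yes-instance if and only if $I$ is one, and which satisfies $|I'|+k'\le g(k)$, $|V(G')|\le C k^5$ and $|V(G'_f)|=|E(G')|\le C k^5$. -/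

import Mathlib

/-! # A random access machine with step counting -/

namespace RAM

/-- The state of the machine: registers indexed by natural numbers and unbounded arrays indexed by
natural numbers.  Every cell holds a natural number.  A fixed program only mentions finitely many
registers and arrays. -/
structure Store where
  reg : ℕ → ℕ
  arr : ℕ → ℕ → ℕ

/-- Expressions: constants, registers, indirect reads from an array, addition and truncated
subtraction.  There is no multiplication, so with unit costs a run of `T` steps only produces
numbers whose bit length exceeds that of the input by `O(T)`; "polynomially many steps" therefore
has the same meaning as for Turing machines. -/
inductive Expr : Type
  | const (c : ℕ)
  | reg (x : ℕ)
  | read (a : ℕ) (i : Expr)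
  | add (e₁ e₂ : Expr)
  | sub (e₁ e₂ : Expr)

/-- The value of an expression in a state. -/
def Expr.eval (σ : Store) : Expr → ℕ
  | .const c => c
  | .reg x => σ.reg x
  | .read a i => σ.arr a (i.eval σ)
  | .add e₁ e₂ => e₁.eval σ + e₂.eval σ
  | .sub e₁ e₂ => e₁.eval σ - e₂.eval σ

/-- The number of elementary operations made by the evaluation of an expression. -/
def Expr.cost : Expr → ℕ
  | .const _ => 1
  | .reg _ => 1
  | .read _ i => i.cost + 1
  | .add e₁ e₂ => e₁.cost + e₂.cost + 1
  | .sub e₁ e₂ => e₁.cost + e₂.cost + 1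

/-- Programs.  A test `e` succeeds when the value of `e` is nonzero. -/
inductive Prog : Type
  | skip
  /-- register `x` := `e` -/
  | assign (x : ℕ) (e : Expr)
  /-- cell `i` of array `a` := `e` -/
  | write (a : ℕ) (i e : Expr)
  | seq (p q : Prog)
  | ite (e : Expr) (p q : Prog)
  | loop (e : Expr) (p : Prog)

/-- The state after assigning `v` to register `x`. -/
def Store.setReg (σ : Store) (x v : ℕ) : Store where
  reg := Function.update σ.reg x v
  arr := σ.arr

/-- The state after writing `v` into cell `i` of array `a`. -/
def Store.setArr (σ : Store) (a i v : ℕ) : Store where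
  reg := σ.reg
  arr := Function.update σ.arr a (Function.update (σ.arr a) i v)

/-- `Run p σ T τ`: started in state `σ`, the program `p` halts in state `τ` after exactly `T`
elementary steps. -/
inductive Run : Prog → Store → ℕ → Store → Prop
  | skip (σ : Store) : Run .skip σ 1 σ
  | assign (σ : Store) (x : ℕ) (e : Expr) :
      Run (.assign x e) σ (e.cost + 1) (σ.setReg x (e.eval σ))
  | write (σ : Store) (a : ℕ) (i e : Expr) :
      Run (.write a i e) σ (i.cost + e.cost + 1) (σ.setArr a (i.eval σ) (e.eval σ))
  | seq {p q : Prog} {σ τ υ : Store} {T T' : ℕ} :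
      Run p σ T τ → Run q τ T' υ → Run (.seq p q) σ (T + T') υ
  | ite_true {e : Expr} {p q : Prog} {σ τ : Store} {T : ℕ} :
      e.eval σ ≠ 0 → Run p σ T τ → Run (.ite e p q) σ (e.cost + 1 + T) τ
  | ite_false {e : Expr} {p q : Prog} {σ τ : Store} {T : ℕ} :
      e.eval σ = 0 → Run q σ T τ → Run (.ite e p q) σ (e.cost + 1 + T) τ
  | loop_exit {e : Expr} {p : Prog} {σ : Store} :
      e.eval σ = 0 → Run (.loop e p) σ (e.cost + 1) σ
  | loop_step {e : Expr} {p : Prog} {σ τ υ : Store} {T T' : ℕ} :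
      e.eval σ ≠ 0 → Run p σ T τ → Run (.loop e p) τ T' υ →
      Run (.loop e p) σ (e.cost + 1 + T + T') υ

/-- The initial state: the input word is in array `0`, everything else is zero. -/
def Store.init (w : List ℕ) : Store where
  reg := fun _ => 0
  arr := fun a i => if a = 0 then w.getD i 0 else 0

/-- On input `w`, the program `p` halts after at most `T` steps, and then array `1` starts with
the word `w'`.  (This is used with self-delimiting words `w'`, so that the output is determined by
the contents of array `1`.) -/
def Prog.Outputs (p : Prog) (w : List ℕ) (T : ℕ) (w' : List ℕ) : Prop :=
  ∃ (T' : ℕ) (τ : Store), T' ≤ T ∧ Run p (Store.init w) T' τ ∧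
    ∀ i : Fin w'.length, τ.arr 1 i = w'.get i

end RAM

/-! # Shortest Path with Forcing Graph -/

namespace SPFG

/-- An instance: a simple undirected graph `G` (on the vertices `0, …, n - 1`), a forcing graph
`Gf` whose vertices are the edges of `G`, two distinct vertices `s`, `t` of `G`, and a positive
integer `k`, which is the parameter. -/
structure Instance where
  n : ℕ
  G : SimpleGraph (Fin n)
  Gf : SimpleGraph G.edgeSet
  s : Fin n
  t : Fin n
  k : ℕ
  s_ne_t : s ≠ t
  k_pos : 0 < k

namespace Instance

/-- `S` is a solution: it has at most `k` edges, the subgraph `(V, S)` contains an `s`-`t` path,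
and `S` is a vertex cover of the forcing graph. -/
def IsSolution (I : Instance) (S : Set I.G.edgeSet) : Prop :=
  S.ncard ≤ I.k ∧
    (SimpleGraph.fromEdgeSet (Subtype.val '' S : Set (Sym2 (Fin I.n)))).Reachable I.s I.t ∧
    I.Gf.IsVertexCover S

/-- `I` is a yes-instance. -/
def IsYes (I : Instance) : Prop := ∃ S : Set I.G.edgeSet, I.IsSolution S

/-- The number of edges of `G`, which is the number of vertices of the forcing graph. -/
noncomputable def numEdges (I : Instance) : ℕ := I.G.edgeSet.ncard

/-- The number of edges of the forcing graph. -/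
noncomputable def numForcing (I : Instance) : ℕ := I.Gf.edgeSet.ncard

/-- The size `|I|` of an instance: the numbers of vertices and edges of `G`, the number of edges
of the forcing graph, and the length of the binary representation of `k`. -/
noncomputable def size (I : Instance) : ℕ :=
  I.n + I.numEdges + I.numForcing + Nat.size I.k

/-- A presentation of an instance by lists: the `m` edges of `G` are numbered, the `i`-th one is
written as a pair of end vertices; the `p` edges of the forcing graph are numbered, the `j`-th one
is written as a pair of numbers of edges of `G`. -/
structure Presentation (I : Instance) where
  m : ℕ
  p : ℕ
  edge : Fin m ≃ I.G.edgeSet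
  ends : Fin m → Fin I.n × Fin I.n
  ends_spec : ∀ i, ((edge i : I.G.edgeSet) : Sym2 (Fin I.n)) = s((ends i).1, (ends i).2)
  forcing : Fin p ≃ I.Gf.edgeSet
  pair : Fin p → Fin m × Fin m
  pair_spec : ∀ j, ((forcing j : I.Gf.edgeSet) : Sym2 I.G.edgeSet) =
    s(edge (pair j).1, edge (pair j).2)

/-- The word `n m p s t k u₁ v₁ … uₘ vₘ a₁ b₁ … aₚ bₚ` belonging to a presentation: edge `i` of `G`
joins `uᵢ` and `vᵢ`, edge `j` of the forcing graph joins the edges number `aⱼ` and `bⱼ` of `G`. -/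
def Presentation.word {I : Instance} (P : Presentation I) : List ℕ :=
  [I.n, P.m, P.p, (I.s : ℕ), (I.t : ℕ), I.k] ++
    (List.ofFn P.ends).flatMap (fun e => [(e.1 : ℕ), (e.2 : ℕ)]) ++
    (List.ofFn P.pair).flatMap (fun e => [(e.1 : ℕ), (e.2 : ℕ)])

/-- The word `w` encodes the instance `I`. -/
def Encodes (I : Instance) (w : List ℕ) : Prop := ∃ P : Presentation I, P.word = w

end Instance

/-- `Q` is a kernelization, within the given bounds: on every encoding of every instance `I`, it
outputs, in at most `time |I|` steps, an encoding of an equivalent instance `I'` such that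
`|I'| + k' ≤ size k`, and such that the graph of `I'` has at most `vert k` vertices and at most
`edges k` edges. -/
def IsKernelization (Q : RAM.Prog) (time size vert edges : ℕ → ℕ) : Prop :=
  ∀ (I : Instance) (w : List ℕ), I.Encodes w →
    ∃ (I' : Instance) (w' : List ℕ), I'.Encodes w' ∧ Q.Outputs w (time I.size) w' ∧
      (I.IsYes ↔ I'.IsYes) ∧
      I'.size + I'.k ≤ size I.k ∧
      I'.n ≤ vert I.k ∧
      I'.numEdges ≤ edges I.k

end SPFG

/-!
The idea of the kernelization is to separate the edges that matter for the vertex cover from the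
edges that only matter for the connection of `s` and `t`.

*Forcing edges.* The forcing edges are read one after the other, and a forcing edge is discarded if
one of its ends already has more than `k` surviving partners, or if more than `k * (k + 1)` forcing
edges have survived. A set of at most `k` elements that covers all surviving forcing edges contains
every element with more than `k` surviving partners, and there are at most `k * (k + 1)` surviving
forcing edges because every element has at most `k + 1` surviving partners. Hence nothing changes for
solutions of size at most `k` (`Covers.of_kept`), and at most `O(k ^ 2)` edges of the graph are
relevant, that is, incident with a surviving forcing edge.

*Free edges.* The other edges are free: a solution consists of a cover `A` among the relevant edges
and of free edges, and the latter are best counted along a walk from `s` to `t` on which edges in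
`A` cost nothing (`Raw.isYes_iff_wReach`; the walk may be assumed to be a path, which pays only once
for each free edge). Such a walk consists of relevant edges and of free walks between terminals,
the ends of relevant edges together with `s` and `t`. There are `O(k ^ 2)` terminals, and for each
pair of them at distance at most `k` in the graph of free edges, the kernel contains a path of that
length with fresh inner vertices. This gives `O(k ^ 4)` paths with `O(k)` edges each. Walks are
translated in both directions by `Raw.Valid.follow_in_kernel` and `Raw.Valid.follow_in_original`;
in the second one, a walk that turns back inside an inserted path is handled by remembering only the
cost at which one of the two ends of the path is reached.

*The machine.* Since a budget `k` above the number of edges may be lowered, all loops of the program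
are counting loops with at most `|I| + 1` rounds, and a polynomial time bound can be read off from
the syntax of the program (`Prog.timePoly`). The correctness of the program is derived with the rules
for `Ends`; `Frame`, also read off from the syntax, says what a program leaves unchanged. The
distances are computed by the algorithm of Bellman and Ford, started once from each terminal, with
`k` rounds.
-/

namespace SPFG

open Relation

/-! ### Numerical instances -/

/-- An instance written with natural numbers only: `E` lists the pairs of ends of the edges of the
graph, and `F` lists the pairs of positions in `E` that are joined by the forcing graph. -/
structure Raw where
  n : ℕ
  E : List (ℕ × ℕ)
  F : List (ℕ × ℕ)
  s : ℕ
  t : ℕ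
  k : ℕ

/-- The concatenation of a list of pairs. -/
def flat (L : List (ℕ × ℕ)) : List ℕ := L.flatMap fun e => [e.1, e.2]

/-- `L` lists the edges of a simple graph on `0, …, N - 1`, each edge once. -/
structure SimplePairs (N : ℕ) (L : List (ℕ × ℕ)) : Prop where
  lt_left : ∀ e ∈ L, e.1 < N
  lt_right : ∀ e ∈ L, e.2 < N
  ne : ∀ e ∈ L, e.1 ≠ e.2
  nodup : (L.map fun e => s(e.1, e.2)).Nodup

/-- `S` meets every pair in `F`. -/
def Covers (F : List (ℕ × ℕ)) (S : Finset ℕ) : Prop := ∀ f ∈ F, f.1 ∈ S ∨ f.2 ∈ S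

/-- The `i`-th pair in `E` has the ends `x` and `y`. -/
def Joins (E : List (ℕ × ℕ)) (i x y : ℕ) : Prop := E[i]? = some (x, y) ∨ E[i]? = some (y, x)

theorem Joins.symm {E : List (ℕ × ℕ)} {i x y : ℕ} (h : Joins E i x y) : Joins E i y x := Or.symm h

namespace Raw

/-- The word that encodes a numerical instance. -/
def word (R : Raw) : List ℕ :=
  [R.n, R.E.length, R.F.length, R.s, R.t, R.k] ++ flat R.E ++ flat R.F

/-- The lists describe simple graphs, and `s`, `t`, `k` are as in an instance. -/
structure Valid (R : Raw) : Prop where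
  E : SimplePairs R.n R.E
  F : SimplePairs R.E.length R.F
  s_lt : R.s < R.n
  t_lt : R.t < R.n
  s_ne_t : R.s ≠ R.t
  k_pos : 0 < R.k

/-- There is a cover of at most `k` positions in `E` that connects `s` with `t`. Positions beyond the
end of `E` are harmless: they join nothing. -/
def IsYes (R : Raw) : Prop :=
  ∃ S : Finset ℕ, S.card ≤ R.k ∧ Covers R.F S ∧
    ReflTransGen (fun x y => ∃ i ∈ S, Joins R.E i x y) R.s R.t

end Raw

namespace Instance.Presentation

variable {I : Instance} (P : Presentation I)

/-- The numerical form of a presented instance. -/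
def raw : Raw where
  n := I.n
  E := (List.ofFn P.ends).map fun e => ((e.1 : ℕ), (e.2 : ℕ))
  F := (List.ofFn P.pair).map fun e => ((e.1 : ℕ), (e.2 : ℕ))
  s := I.s
  t := I.t
  k := I.k

theorem raw_word : P.raw.word = P.word := by
  simp [raw, Raw.word, word, flat, -List.map_ofFn, List.flatMap_map]

theorem numEdges_eq : I.numEdges = P.m := by
  rw [Instance.numEdges, ← Nat.card_coe_set_eq, ← Nat.card_congr P.edge, Nat.card_eq_fintype_card,
    Fintype.card_fin]

theorem numForcing_eq : I.numForcing = P.p := by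
  rw [Instance.numForcing, ← Nat.card_coe_set_eq, ← Nat.card_congr P.forcing,
    Nat.card_eq_fintype_card, Fintype.card_fin]

theorem simplePairs_ofFn {m N : ℕ} (f : Fin m → Fin N × Fin N)
    (hne : ∀ i, (f i).1 ≠ (f i).2) (hinj : Function.Injective fun i => s((f i).1, (f i).2)) :
    SimplePairs N ((List.ofFn f).map fun e => ((e.1 : ℕ), (e.2 : ℕ))) := by
  constructor
  · simp
  · simp
  · simpa [Fin.val_inj] using hne
  · rw [List.map_map, List.map_ofFn, List.nodup_ofFn]
    have : ((fun e : ℕ × ℕ => s(e.1, e.2)) ∘ fun e : Fin N × Fin N => ((e.1 : ℕ), (e.2 : ℕ))) ∘ f =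
        Sym2.map Fin.val ∘ fun i => s((f i).1, (f i).2) := by
      funext i; simp
    rw [this]
    exact (Sym2.map.injective Fin.val_injective).comp hinj

theorem raw_valid : P.raw.Valid := by
  have hedge : Function.Injective fun i => s((P.ends i).1, (P.ends i).2) := by
    intro i j h
    simp only [← P.ends_spec] at h
    exact P.edge.injective (Subtype.ext h)
  have hpair : Function.Injective fun j => s((P.pair j).1, (P.pair j).2) := by
    intro i j h
    apply P.forcing.injective
    apply Subtype.ext
    rw [P.pair_spec, P.pair_spec]
    simpa using congrArg (Sym2.map P.edge) h
  refine ⟨simplePairs_ofFn _ (fun i => ?_) hedge, ?_, I.s.2, I.t.2,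
    fun h => I.s_ne_t (Fin.ext h), I.k_pos⟩
  · have h := (P.edge i).2
    rw [P.ends_spec, SimpleGraph.mem_edgeSet] at h
    exact h.ne
  · have := simplePairs_ofFn P.pair (fun i => ?_) hpair
    · simpa [raw] using this
    · have h := (P.forcing i).2
      rw [P.pair_spec, SimpleGraph.mem_edgeSet] at h
      exact fun e => h.ne (by rw [e])

theorem joins_raw (i : Fin P.m) (x y : Fin I.n) :
    Joins P.raw.E i x y ↔ ((P.edge i : I.G.edgeSet) : Sym2 (Fin I.n)) = s(x, y) := by
  rw [P.ends_spec, Sym2.eq_iff]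
  simp [Joins, raw, Fin.ext_iff]

/-- Two vertices are joined by a chosen edge of the graph precisely when they are joined by a pair
whose position is chosen. -/
theorem reachable_iff (S : Set I.G.edgeSet) (U : Finset ℕ)
    (hU : ∀ i : Fin P.m, (i : ℕ) ∈ U ↔ P.edge i ∈ S) :
    (SimpleGraph.fromEdgeSet (Subtype.val '' S : Set (Sym2 (Fin I.n)))).Reachable I.s I.t ↔
      ReflTransGen (fun x y => ∃ i ∈ U, Joins P.raw.E i x y) I.s I.t := by
  rw [SimpleGraph.reachable_iff_reflTransGen]
  have key : ∀ x y : Fin I.n,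
      (SimpleGraph.fromEdgeSet (Subtype.val '' S : Set (Sym2 (Fin I.n)))).Adj x y ↔
        ∃ i ∈ U, Joins P.raw.E i x y := by
    intro x y
    rw [SimpleGraph.fromEdgeSet_adj]
    constructor
    · rintro ⟨⟨e, he, hxy⟩, -⟩
      obtain ⟨i, rfl⟩ := P.edge.surjective e
      exact ⟨i, (hU i).2 he, (P.joins_raw i x y).2 hxy⟩
    · rintro ⟨i, hi, h⟩
      have him : i < P.m := by
        by_contra hlt
        rcases h with h | h <;> simp [raw, hlt] at h
      have h' := (P.joins_raw ⟨i, him⟩ x y).1 h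
      refine ⟨⟨_, (hU ⟨i, him⟩).1 hi, h'⟩, ?_⟩
      have h2 := (P.edge ⟨i, him⟩).2
      rw [h', SimpleGraph.mem_edgeSet] at h2
      exact h2.ne
  constructor
  · exact fun h => h.lift Fin.val fun x y hxy => (key x y).1 hxy
  · intro h
    have : ∀ z : ℕ, ReflTransGen (fun x y => ∃ i ∈ U, Joins P.raw.E i x y) I.s z →
        ∃ z' : Fin I.n, (z' : ℕ) = z ∧ ReflTransGen (SimpleGraph.fromEdgeSet
          (Subtype.val '' S : Set (Sym2 (Fin I.n)))).Adj I.s z' := by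
      intro z hz
      induction hz with
      | refl => exact ⟨I.s, rfl, .refl⟩
      | tail _ hstep ih =>
        obtain ⟨z', rfl, hz'⟩ := ih
        obtain ⟨i, hi, hj⟩ := hstep
        have hE := P.raw_valid.E
        rename_i c _
        have hc : c < I.n := by
          rcases hj with h | h
          · exact hE.lt_right _ (List.mem_of_getElem? h)
          · exact hE.lt_left _ (List.mem_of_getElem? h)
        exact ⟨⟨c, hc⟩, rfl, hz'.tail ((key _ ⟨c, hc⟩).2 ⟨i, hi, hj⟩)⟩
    obtain ⟨z', hz, h'⟩ := this _ h
    rwa [Fin.ext hz] at h'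

theorem isVertexCover_iff (S : Set I.G.edgeSet) (U : Finset ℕ)
    (hU : ∀ i : Fin P.m, (i : ℕ) ∈ U ↔ P.edge i ∈ S) :
    I.Gf.IsVertexCover S ↔ Covers P.raw.F U := by
  constructor
  · intro h f hf
    simp only [raw, List.mem_map, List.mem_ofFn] at hf
    obtain ⟨_, ⟨j, rfl⟩, rfl⟩ := hf
    simp only [hU]
    have hj := (P.forcing j).2
    rw [P.pair_spec, SimpleGraph.mem_edgeSet] at hj
    exact h hj
  · intro h a b hab
    obtain ⟨j, hj⟩ := P.forcing.surjective ⟨s(a, b), hab⟩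
    have h1 := congrArg Subtype.val hj
    rw [P.pair_spec] at h1
    have h2 := h (((P.pair j).1 : ℕ), ((P.pair j).2 : ℕ))
      (List.mem_map.2 ⟨_, (List.mem_ofFn' _ _).2 ⟨j, rfl⟩, rfl⟩)
    simp only [hU] at h2
    rcases Sym2.eq_iff.1 h1 with ⟨rfl, rfl⟩ | ⟨rfl, rfl⟩
    · exact h2
    · exact h2.symm

theorem isYes_raw_iff : P.raw.IsYes ↔ I.IsYes := by
  classical
  constructor
  · rintro ⟨U, hcard, hcov, hreach⟩
    have hU : ∀ i : Fin P.m, (i : ℕ) ∈ U ↔ P.edge i ∈ {e | ((P.edge.symm e : Fin P.m) : ℕ) ∈ U} := by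
      simp
    refine ⟨_, le_trans ?_ hcard, (P.reachable_iff _ U hU).2 hreach,
      (P.isVertexCover_iff _ U hU).2 hcov⟩
    rw [← Set.ncard_coe_finset]
    refine Set.ncard_le_ncard_of_injOn (fun e => ((P.edge.symm e : Fin P.m) : ℕ)) (fun e he => he)
      (fun a _ b _ h => ?_) (Finset.finite_toSet _)
    simpa [Fin.val_inj] using h
  · rintro ⟨S, hcard, hreach, hcov⟩
    set U : Finset ℕ := (Finset.univ.filter fun i => P.edge i ∈ S).map Fin.valEmbedding with hUdef
    have hU : ∀ i : Fin P.m, (i : ℕ) ∈ U ↔ P.edge i ∈ S := by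
      intro i
      simp [hUdef, Fin.val_inj]
    refine ⟨U, le_trans ?_ hcard, (P.isVertexCover_iff _ U hU).1 hcov,
      (P.reachable_iff _ U hU).1 hreach⟩
    rw [hUdef, Finset.card_map, ← Set.ncard_coe_finset]
    exact Set.ncard_le_ncard_of_injOn P.edge (by simp) P.edge.injective.injOn
      (Finite.of_equiv _ P.edge |> fun _ => Set.toFinite S)

end Instance.Presentation

/-- An injective family of non-loops enumerates the edge set of the simple graph that it spans. -/
noncomputable def edgeEquiv {V : Type*} {m : ℕ} (f : Fin m → Sym2 V) (hf : Function.Injective f)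
    (hd : ∀ i, ¬ (f i).IsDiag) : Fin m ≃ (SimpleGraph.fromEdgeSet (Set.range f)).edgeSet :=
  (Equiv.ofInjective f hf).trans <| Equiv.setCongr <| by
    rw [SimpleGraph.edgeSet_fromEdgeSet]
    ext e
    constructor
    · rintro ⟨i, rfl⟩
      exact ⟨⟨i, rfl⟩, hd i⟩
    · exact fun h => h.1

/-- The pairs of a list of edges, as pairs of elements of `Fin N`. -/
def SimplePairs.toFin {N : ℕ} {L : List (ℕ × ℕ)} (h : SimplePairs N L) (i : Fin L.length) :
    Fin N × Fin N :=
  (⟨(L.get i).1, h.lt_left _ (L.get_mem i)⟩, ⟨(L.get i).2, h.lt_right _ (L.get_mem i)⟩)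

theorem SimplePairs.toFin_injective {N : ℕ} {L : List (ℕ × ℕ)} (h : SimplePairs N L) :
    Function.Injective fun i => s((h.toFin i).1, (h.toFin i).2) := by
  intro i j hij
  have h1 := congrArg (Sym2.map Fin.val) hij
  simp only [Sym2.map_mk, toFin] at h1
  have h2 := h.nodup
  rw [List.nodup_iff_injective_get] at h2
  have h3 := @h2 ⟨i, by simp⟩ ⟨j, by simp⟩ (by simpa using h1)
  simpa [Fin.ext_iff] using h3

theorem SimplePairs.toFin_ne {N : ℕ} {L : List (ℕ × ℕ)} (h : SimplePairs N L) (i : Fin L.length) :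
    (h.toFin i).1 ≠ (h.toFin i).2 := by
  simpa [toFin] using h.ne _ (L.get_mem i)

theorem SimplePairs.map_ofFn_toFin {N : ℕ} {L : List (ℕ × ℕ)} (h : SimplePairs N L) :
    ((List.ofFn h.toFin).map fun e => ((e.1 : ℕ), (e.2 : ℕ))) = L := by
  rw [List.map_ofFn]
  exact List.ofFn_get L

/-- Every valid numerical instance is the numerical form of a presented instance. -/
theorem Raw.Valid.exists_presentation {R : Raw} (h : R.Valid) :
    ∃ (I : Instance) (P : I.Presentation), P.raw = R := by
  have hd : ∀ i, ¬ (s((h.E.toFin i).1, (h.E.toFin i).2)).IsDiag := fun i => by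
    simpa using h.E.toFin_ne i
  set edge := edgeEquiv _ h.E.toFin_injective hd with hedge
  have hfi : Function.Injective
      fun j => s(edge (h.F.toFin j).1, edge (h.F.toFin j).2) := by
    intro i j hij
    refine h.F.toFin_injective (Sym2.map.injective edge.injective ?_)
    simpa using hij
  have hfd : ∀ j, ¬ (s(edge (h.F.toFin j).1, edge (h.F.toFin j).2)).IsDiag := fun j => by
    simpa using h.F.toFin_ne j
  refine ⟨⟨R.n, _, SimpleGraph.fromEdgeSet (Set.range fun j =>
      s(edge (h.F.toFin j).1, edge (h.F.toFin j).2)), ⟨R.s, h.s_lt⟩, ⟨R.t, h.t_lt⟩, R.k,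
      by simpa using h.s_ne_t, h.k_pos⟩,
    ⟨R.E.length, R.F.length, edge, h.E.toFin, fun i => rfl, edgeEquiv _ hfi hfd, h.F.toFin,
      fun j => rfl⟩, ?_⟩
  simp only [Instance.Presentation.raw, h.E.map_ofFn_toFin, h.F.map_ofFn_toFin]

end SPFG

namespace SPFG

open Relation

/-! ### Walks with free and paid steps -/

/-- `WReach Z O s c x`: there is a walk from `s` to `x` with steps in `Z` and in `O`, exactly `c`
of them counted as steps in `O`. -/
inductive WReach (Z O : ℕ → ℕ → Prop) (s : ℕ) : ℕ → ℕ → Prop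
  | refl : WReach Z O s 0 s
  | zero {c x y : ℕ} : WReach Z O s c x → Z x y → WReach Z O s c y
  | one {c x y : ℕ} : WReach Z O s c x → O x y → WReach Z O s (c + 1) y

theorem WReach.trans {Z O : ℕ → ℕ → Prop} {s c x d y : ℕ} (h : WReach Z O s c x)
    (h' : WReach Z O x d y) : WReach Z O s (c + d) y := by
  induction h' with
  | refl => exact h
  | zero _ hz ih => exact ih.zero hz
  | one _ ho ih => exact ih.one ho

theorem WReach.mono {Z Z' O O' : ℕ → ℕ → Prop} (hZ : ∀ x y, Z x y → Z' x y)
    (hO : ∀ x y, O x y → O' x y) {s c x : ℕ} (h : WReach Z O s c x) : WReach Z' O' s c x := by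
  induction h with
  | refl => exact .refl
  | zero _ hz ih => exact ih.zero (hZ _ _ hz)
  | one _ ho ih => exact ih.one (hO _ _ ho)

/-- A walk in a graph all of whose steps are in `Z` or in `O`: only the edges that are not in `Z`
have to be paid. -/
theorem WReach.of_walk {Z O : ℕ → ℕ → Prop} {G : SimpleGraph ℕ} (D : Set (Sym2 ℕ))
    [DecidablePred (· ∈ D)] (hZ : ∀ x y, G.Adj x y → s(x, y) ∈ D → Z x y)
    (hO : ∀ x y, G.Adj x y → s(x, y) ∉ D → O x y) {x y : ℕ} (p : G.Walk x y) :
    WReach Z O x ((p.edges.filter (· ∉ D)).length) y := by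
  induction p with
  | nil => exact .refl
  | cons h p ih =>
    rename_i u v w
    by_cases hD : s(u, v) ∈ D
    · have := (WReach.refl.zero (hZ _ _ h hD)).trans ih
      simpa [hD] using this
    · have := (WReach.refl.one (hO _ _ h hD)).trans ih
      simpa [hD, add_comm] using this

/-- The steps along the pairs at the positions in `A`. -/
def Along (E : List (ℕ × ℕ)) (A : Finset ℕ) (x y : ℕ) : Prop := ∃ i ∈ A, Joins E i x y

/-- The steps along the pairs at the positions outside `A`. -/
def Outside (E : List (ℕ × ℕ)) (A : Finset ℕ) (x y : ℕ) : Prop := ∃ i ∉ A, Joins E i x y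

theorem Along.symm {E : List (ℕ × ℕ)} {A : Finset ℕ} {x y : ℕ} (h : Along E A x y) :
    Along E A y x := let ⟨i, hi, h⟩ := h; ⟨i, hi, h.symm⟩

theorem Outside.symm {E : List (ℕ × ℕ)} {A : Finset ℕ} {x y : ℕ} (h : Outside E A x y) :
    Outside E A y x := let ⟨i, hi, h⟩ := h; ⟨i, hi, h.symm⟩

/-- A simple path inside `S` pays at most once for each element of `S` outside `A₀`. -/
theorem exists_wReach_of_reflTransGen (E : List (ℕ × ℕ)) (S A₀ : Finset ℕ) (s t : ℕ)
    (h : ReflTransGen (Along E S) s t) :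
    ∃ c ≤ (S \ A₀).card, WReach (Along E (S ∩ A₀)) (Outside E A₀) s c t := by
  classical
  set G : SimpleGraph ℕ := SimpleGraph.fromRel (Along E S) with hG
  have hadj : ∀ x y, G.Adj x y → Along E S x y := by
    intro x y hxy
    rw [hG, SimpleGraph.fromRel_adj] at hxy
    exact hxy.2.elim id Along.symm
  have hreach : G.Reachable s t := by
    clear_value G
    induction h with
    | refl => exact .refl _
    | tail _ hxy ih =>
      rename_i b c _
      by_cases hbc : b = c
      · exact hbc ▸ ih
      · exact ih.trans (SimpleGraph.Adj.reachable (by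
          rw [hG, SimpleGraph.fromRel_adj]; exact ⟨hbc, .inl hxy⟩))
  obtain ⟨p, hp⟩ := hreach.exists_isPath
  let D : Set (Sym2 ℕ) := {e | ∃ x y, e = s(x, y) ∧ Along E (S ∩ A₀) x y}
  have hD : ∀ x y, s(x, y) ∈ D → Along E (S ∩ A₀) x y := by
    rintro x y ⟨a, b, hab, h⟩
    rcases Sym2.eq_iff.1 hab with ⟨rfl, rfl⟩ | ⟨rfl, rfl⟩
    · exact h
    · exact h.symm
  have hout : ∀ x y, G.Adj x y → s(x, y) ∉ D → ∃ i ∈ S \ A₀, Joins E i x y := by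
    intro x y hxy hn
    obtain ⟨i, hi, hj⟩ := hadj x y hxy
    refine ⟨i, Finset.mem_sdiff.2 ⟨hi, fun hA => hn ⟨x, y, rfl, i, ?_, hj⟩⟩, hj⟩
    exact Finset.mem_inter.2 ⟨hi, hA⟩
  refine ⟨_, ?_, WReach.of_walk D (fun x y _ => hD x y) (fun x y hxy hn => ?_) p⟩
  · have hnd : (p.edges.filter (· ∉ D)).Nodup := hp.isTrail.edges_nodup.filter _
    rw [← List.toFinset_card_of_nodup hnd]
    refine le_trans (Finset.card_le_card ?_)
      (Finset.card_image_le (s := S \ A₀)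
        (f := fun i => s((E.getD i (0, 0)).1, (E.getD i (0, 0)).2)))
    intro e he
    rw [List.mem_toFinset, List.mem_filter] at he
    obtain ⟨he, hn⟩ := he
    induction e using Sym2.ind with
    | _ x y =>
      obtain ⟨i, hi, hj⟩ := hout x y (p.adj_of_mem_edges he) (by simpa using hn)
      refine Finset.mem_image.2 ⟨i, hi, ?_⟩
      rcases hj with h | h <;> simp [List.getD, h, Sym2.eq_swap]
  · obtain ⟨i, hi, hj⟩ := hout x y hxy hn
    exact ⟨i, (Finset.mem_sdiff.1 hi).2, hj⟩

theorem WReach.exists_finset {E : List (ℕ × ℕ)} {A A₀ : Finset ℕ} {s c t : ℕ}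
    (h : WReach (Along E A) (Outside E A₀) s c t) :
    ∃ S : Finset ℕ, S.card ≤ c ∧ ReflTransGen (Along E (A ∪ S)) s t := by
  classical
  have mono : ∀ {S S' : Finset ℕ} {x y : ℕ}, S ⊆ S' → ReflTransGen (Along E S) x y →
      ReflTransGen (Along E S') x y := fun hS h =>
    h.lift id fun x y ⟨i, hi, hj⟩ => ⟨i, hS hi, hj⟩
  induction h with
  | refl => exact ⟨∅, le_rfl, .refl⟩
  | zero _ hz ih =>
    obtain ⟨S, hS, h⟩ := ih
    obtain ⟨i, hi, hj⟩ := hz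
    exact ⟨S, hS, h.tail ⟨i, Finset.mem_union_left _ hi, hj⟩⟩
  | one _ ho ih =>
    obtain ⟨S, hS, h⟩ := ih
    obtain ⟨i, hi, hj⟩ := ho
    refine ⟨insert i S, (Finset.card_insert_le _ _).trans (by omega), (mono ?_ h).tail
      ⟨i, by simp, hj⟩⟩
    exact Finset.union_subset_union_right (Finset.subset_insert _ _)

theorem Covers.mono {F : List (ℕ × ℕ)} {S S' : Finset ℕ} (h : Covers F S) (hS : S ⊆ S') :
    Covers F S' := fun f hf => (h f hf).imp (@hS _) (@hS _)

/-- The edges outside `A₀` matter for the connection only, hence it is enough to choose a cover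
inside `A₀` and to count the other edges along a walk. -/
theorem Raw.isYes_iff_wReach (R : Raw) (A₀ : Finset ℕ)
    (hF : ∀ f ∈ R.F, f.1 ∈ A₀ ∧ f.2 ∈ A₀) :
    R.IsYes ↔ ∃ A ⊆ A₀, Covers R.F A ∧
      ∃ c, A.card + c ≤ R.k ∧ WReach (Along R.E A) (Outside R.E A₀) R.s c R.t := by
  classical
  constructor
  · rintro ⟨S, hcard, hcov, hreach⟩
    obtain ⟨c, hc, hw⟩ := exists_wReach_of_reflTransGen R.E S A₀ R.s R.t hreach
    refine ⟨S ∩ A₀, Finset.inter_subset_right, fun f hf => ?_, c, ?_, hw⟩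
    · simp [hF f hf, hcov f hf]
    · have := Finset.card_sdiff_add_card_inter S A₀
      omega
  · rintro ⟨A, -, hcov, c, hc, hw⟩
    obtain ⟨S, hS, h⟩ := hw.exists_finset
    exact ⟨A ∪ S, (Finset.card_union_le _ _).trans (by omega),
      hcov.mono Finset.subset_union_left, h⟩

/-- A budget above the number of edges may be lowered to the number of edges plus one. -/
theorem Raw.isYes_cap (R : Raw) (hF : SimplePairs R.E.length R.F) :
    Raw.IsYes { R with k := min R.k (R.E.length + 1) } ↔ R.IsYes := by
  classical
  constructor
  · rintro ⟨S, h, h'⟩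
    exact ⟨S, le_trans h (min_le_left _ _), h'⟩
  · rintro ⟨S, hcard, hcov, hreach⟩
    refine ⟨S ∩ Finset.range R.E.length, le_min ?_ ?_, fun f hf => ?_, hreach.lift id ?_⟩
    · exact (Finset.card_le_card Finset.inter_subset_left).trans hcard
    · refine (Finset.card_le_card Finset.inter_subset_right).trans ?_
      simp
    · simp [hF.lt_left f hf, hF.lt_right f hf, hcov f hf]
    · rintro x y ⟨i, hi, hj⟩
      refine ⟨i, Finset.mem_inter.2 ⟨hi, Finset.mem_range.2 ?_⟩, hj⟩
      by_contra hlt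
      rcases hj with h | h <;> simp [List.getElem?_eq_none (not_lt.1 hlt)] at h

end SPFG

namespace SPFG

open Relation

/-! ### Discarding forcing edges -/

/-- The number of pairs in `K` that contain `a`. -/
def deg (K : List (ℕ × ℕ)) (a : ℕ) : ℕ := K.countP fun f => f.1 = a ∨ f.2 = a

/-- Append `f` to `K`, unless one of its ends already has more than `k` partners in `K`, or `K` is
already too long to be covered by `k` elements. -/
def keepStep (k : ℕ) (K : List (ℕ × ℕ)) (f : ℕ × ℕ) : List (ℕ × ℕ) :=
  if deg K f.1 ≤ k ∧ deg K f.2 ≤ k ∧ K.length < k * (k + 1) + 1 then K ++ [f] else K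

/-- The pairs of `F` that survive when they are offered to `keepStep` one after the other. -/
def kept (k : ℕ) (F : List (ℕ × ℕ)) : List (ℕ × ℕ) := F.foldl (keepStep k) []

theorem kept_concat (k : ℕ) (F : List (ℕ × ℕ)) (f : ℕ × ℕ) :
    kept k (F ++ [f]) = keepStep k (kept k F) f := by
  simp [kept]

theorem kept_sublist (k : ℕ) (F : List (ℕ × ℕ)) : (kept k F).Sublist F := by
  induction F using List.reverseRecOn with
  | nil => simp [kept]
  | append_singleton F f ih =>
    rw [kept_concat, keepStep]
    split_ifs
    · exact ih.append (List.Sublist.refl _)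
    · exact ih.trans (List.sublist_append_left _ _)

theorem length_kept_le (k : ℕ) (F : List (ℕ × ℕ)) : (kept k F).length ≤ k * (k + 1) + 1 := by
  induction F using List.reverseRecOn with
  | nil => simp [kept]
  | append_singleton F f ih =>
    rw [kept_concat, keepStep]
    split_ifs with h
    · rw [List.length_append]
      exact h.2.2
    · exact ih

theorem deg_concat (K : List (ℕ × ℕ)) (f : ℕ × ℕ) (a : ℕ) :
    deg (K ++ [f]) a = deg K a + if f.1 = a ∨ f.2 = a then 1 else 0 := by
  simp [deg, List.countP_append, List.countP_cons]

theorem deg_kept_le (k : ℕ) (F : List (ℕ × ℕ)) (a : ℕ) : deg (kept k F) a ≤ k + 1 := by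
  induction F using List.reverseRecOn with
  | nil => simp [kept, deg]
  | append_singleton F f ih =>
    rw [kept_concat, keepStep]
    split_ifs with h
    · rw [deg_concat]
      split_ifs with h'
      · rcases h' with rfl | rfl <;> omega
      · exact ih
    · exact ih

/-- An element with more partners than `S` has elements belongs to `S`. -/
theorem Covers.deg_le {K : List (ℕ × ℕ)} {S : Finset ℕ} (h : Covers K S)
    (hK : (K.map fun e => s(e.1, e.2)).Nodup) {a : ℕ} (ha : a ∉ S) : deg K a ≤ S.card := by
  set L := K.filter fun f => f.1 = a ∨ f.2 = a with hL
  set other : ℕ × ℕ → ℕ := fun f => if f.1 = a then f.2 else f.1 with hother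
  have hmap : (L.map other).map (fun b => s(a, b)) = L.map fun e => s(e.1, e.2) := by
    rw [List.map_map]
    refine List.map_congr_left fun f hf => ?_
    have hf' : f.1 = a ∨ f.2 = a := by simpa using (List.mem_filter.1 hf).2
    simp only [Function.comp, hother]
    split_ifs with h1
    · rw [h1]
    · rw [hf'.resolve_left h1, Sym2.eq_swap]
  have hnd : (L.map other).Nodup := by
    refine List.Nodup.of_map (fun b => s(a, b)) ?_
    rw [hmap]
    exact hK.sublist (List.filter_sublist.map _)
  have hdeg : deg K a = (L.map other).toFinset.card := by
    rw [List.toFinset_card_of_nodup hnd, List.length_map, hL, deg, List.countP_eq_length_filter]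
  rw [hdeg]
  refine Finset.card_le_card fun b hb => ?_
  rw [List.mem_toFinset, List.mem_map] at hb
  obtain ⟨f, hf, rfl⟩ := hb
  rw [hL, List.mem_filter] at hf
  have hf' : f.1 = a ∨ f.2 = a := by simpa using hf.2
  have hc := h f hf.1
  simp only [hother]
  split_ifs with h1
  · exact hc.resolve_left (h1 ▸ ha)
  · exact hc.resolve_right ((hf'.resolve_left h1) ▸ ha)

/-- A list covered by few elements of bounded degree is short. -/
theorem Covers.length_le {K : List (ℕ × ℕ)} {S : Finset ℕ} (h : Covers K S) {d : ℕ}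
    (hd : ∀ a, deg K a ≤ d) : K.length ≤ S.card * d := by
  have key : K.length ≤ ∑ a ∈ S, deg K a := by
    clear hd
    induction K using List.reverseRecOn with
    | nil => simp
    | append_singleton K f ih =>
      have h1 := ih fun g hg => h g (by simp [hg])
      have h2 : 1 ≤ ∑ a ∈ S, if f.1 = a ∨ f.2 = a then 1 else 0 := by
        rcases h f (by simp) with hf | hf
        · exact (by simp : 1 ≤ if f.1 = f.1 ∨ f.2 = f.1 then 1 else 0).trans
            (Finset.single_le_sum (f := fun a => if f.1 = a ∨ f.2 = a then 1 else 0)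
              (fun _ _ => Nat.zero_le _) hf)
        · exact (by simp : 1 ≤ if f.1 = f.2 ∨ f.2 = f.2 then 1 else 0).trans
            (Finset.single_le_sum (f := fun a => if f.1 = a ∨ f.2 = a then 1 else 0)
              (fun _ _ => Nat.zero_le _) hf)
      simp only [deg_concat, Finset.sum_add_distrib, List.length_append, List.length_singleton]
      omega
  exact key.trans ((Finset.sum_le_card_nsmul _ _ d fun a _ => hd a).trans (by simp))

/-- A set of at most `k` elements that covers the surviving pairs covers all pairs: a discarded
pair has an end with more than `k` partners among the surviving pairs. -/
theorem Covers.of_kept {k : ℕ} {F : List (ℕ × ℕ)} (hF : (F.map fun e => s(e.1, e.2)).Nodup)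
    {S : Finset ℕ} (hS : S.card ≤ k) (h : Covers (kept k F) S) : Covers F S := by
  induction F using List.reverseRecOn with
  | nil => simp [Covers]
  | append_singleton F f ih =>
    have hF' : (F.map fun e => s(e.1, e.2)).Nodup :=
      hF.sublist ((List.sublist_append_left _ _).map _)
    rw [kept_concat, keepStep] at h
    have hnd := hF'.sublist ((kept_sublist k F).map _)
    intro g hg
    rw [List.mem_append, List.mem_singleton] at hg
    split_ifs at h with hc
    · rcases hg with hg | rfl
      · exact ih hF' (fun g hg => h g (by simp [hg])) g hg
      · exact h g (by simp)
    · rcases hg with hg | rfl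
      · exact ih hF' h g hg
      · by_contra hn
        push Not at hn
        have h1 := h.deg_le hnd hn.1
        have h2 := h.deg_le hnd hn.2
        have h3 := h.length_le (deg_kept_le k F)
        have h4 := Nat.mul_le_mul_right (k + 1) hS
        omega

/-! ### Numbering -/

/-- Append `v` to `L` if it is new. -/
def addNew (L : List ℕ) (v : ℕ) : List ℕ := if v ∈ L then L else L ++ [v]

/-- The elements of a list, without repetitions, in the order of their first occurrences. -/
def number (L : List ℕ) : List ℕ := L.foldl addNew []

theorem number_concat (L : List ℕ) (v : ℕ) : number (L ++ [v]) = addNew (number L) v := by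
  simp [number]

theorem mem_number {L : List ℕ} {v : ℕ} : v ∈ number L ↔ v ∈ L := by
  induction L using List.reverseRecOn with
  | nil => simp [number]
  | append_singleton L w ih =>
    rw [number_concat, addNew]
    split_ifs with h
    · simp only [List.mem_append, List.mem_singleton, ih]
      exact ⟨.inl, fun h' => h'.elim id fun e => e ▸ ih.1 (e ▸ h)⟩
    · simp [ih]

theorem addNew_nodup {L : List ℕ} (h : L.Nodup) (v : ℕ) : (addNew L v).Nodup := by
  rw [addNew]
  split_ifs with hv
  · exact h
  · rw [← List.concat_eq_append]
    exact h.concat hv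

theorem number_nodup (L : List ℕ) : (number L).Nodup := by
  induction L using List.reverseRecOn with
  | nil => simp [number]
  | append_singleton L w ih => exact number_concat L w ▸ addNew_nodup ih w

theorem length_number_le (L : List ℕ) : (number L).length ≤ L.length := by
  induction L using List.reverseRecOn with
  | nil => simp [number]
  | append_singleton L w ih =>
    rw [number_concat, addNew, List.length_append]
    split_ifs <;> simp <;> omega

theorem length_number_le_of_lt {L : List ℕ} {n : ℕ} (h : ∀ v ∈ L, v < n) :
    (number L).length ≤ n := by
  rw [← List.toFinset_card_of_nodup (number_nodup L), ← Finset.card_range n]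
  refine Finset.card_le_card fun v hv => ?_
  rw [List.mem_toFinset, mem_number] at hv
  exact Finset.mem_range.2 (h v hv)

theorem prefix_number_append (L L' : List ℕ) : number L <+: number (L ++ L') := by
  induction L' using List.reverseRecOn with
  | nil => simp
  | append_singleton L' w ih =>
    rw [← List.append_assoc, number_concat]
    refine ih.trans ?_
    rw [addNew]
    split_ifs <;> simp

theorem flat_append (L L' : List (ℕ × ℕ)) : flat (L ++ L') = flat L ++ flat L' := by
  simp [flat]

theorem length_flat (L : List (ℕ × ℕ)) : (flat L).length = 2 * L.length := by
  induction L with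
  | nil => simp [flat]
  | cons e L ih =>
    have : flat (e :: L) = e.1 :: e.2 :: flat L := rfl
    rw [this]
    simp [ih]
    ring

theorem mem_flat {L : List (ℕ × ℕ)} {v : ℕ} : v ∈ flat L ↔ ∃ e ∈ L, v = e.1 ∨ v = e.2 := by
  simp [flat]

theorem getD_flat (L : List (ℕ × ℕ)) (i : ℕ) :
    (flat L).getD (2 * i) 0 = (L.getD i (0, 0)).1 ∧
      (flat L).getD (2 * i + 1) 0 = (L.getD i (0, 0)).2 := by
  induction L generalizing i with
  | nil => simp [flat]
  | cons e L ih =>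
    have : flat (e :: L) = e.1 :: e.2 :: flat L := rfl
    rw [this]
    cases i with
    | zero => simp
    | succ i =>
      rw [show 2 * (i + 1) = 2 * i + 1 + 1 by ring]
      simpa using ih i

theorem getD_idxOf {L : List ℕ} {v : ℕ} (h : v ∈ L) : L.getD (L.idxOf v) 0 = v := by
  have := List.idxOf_lt_length_of_mem h
  simp [List.getD, List.getElem?_eq_getElem this]

theorem idxOf_getD {L : List ℕ} (hL : L.Nodup) {i : ℕ} (h : i < L.length) :
    L.idxOf (L.getD i 0) = i := by
  rw [List.getD_eq_getElem _ _ h]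
  exact hL.idxOf_getElem i h

theorem getD_mem {L : List ℕ} {i : ℕ} (h : i < L.length) : L.getD i 0 ∈ L := by
  rw [List.getD_eq_getElem _ _ h]
  exact List.getElem_mem h

/-! ### Bounded distances -/

/-- `Hops O ℓ a b`: there is a walk of length `ℓ` from `a` to `b` with steps in `O`. -/
def Hops (O : ℕ → ℕ → Prop) (ℓ a b : ℕ) : Prop := WReach (fun _ _ => False) O a ℓ b

theorem Hops.zero {O : ℕ → ℕ → Prop} (a : ℕ) : Hops O 0 a a := WReach.refl

theorem Hops.succ {O : ℕ → ℕ → Prop} {ℓ a b c : ℕ} (h : Hops O ℓ a b) (h' : O b c) :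
    Hops O (ℓ + 1) a c := WReach.one h h'

theorem hops_zero {O : ℕ → ℕ → Prop} {a b : ℕ} : Hops O 0 a b ↔ a = b := by
  refine ⟨fun h => ?_, fun h => h ▸ .zero a⟩
  cases h with
  | refl => rfl
  | zero _ h => exact h.elim

theorem hops_succ {O : ℕ → ℕ → Prop} {ℓ a c : ℕ} :
    Hops O (ℓ + 1) a c ↔ ∃ b, Hops O ℓ a b ∧ O b c := by
  refine ⟨fun h => ?_, fun ⟨b, h, h'⟩ => h.succ h'⟩
  cases h with
  | zero _ h => exact h.elim
  | one h h' => exact ⟨_, h, h'⟩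

theorem Hops.symm {O : ℕ → ℕ → Prop} (hO : ∀ x y, O x y → O y x) {ℓ a b : ℕ} (h : Hops O ℓ a b) :
    Hops O ℓ b a := by
  induction ℓ generalizing b with
  | zero => exact hops_zero.2 (hops_zero.1 h).symm
  | succ ℓ ih =>
    obtain ⟨c, h1, h2⟩ := hops_succ.1 h
    have h3 : Hops O 1 b c := (Hops.zero b).succ (hO _ _ h2)
    have := WReach.trans h3 (ih h1)
    rwa [add_comm] at this

theorem Hops.wReach {Z O : ℕ → ℕ → Prop} {ℓ a b : ℕ} (h : Hops O ℓ a b) : WReach Z O a ℓ b :=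
  h.mono (fun _ _ h => h.elim) fun _ _ h => h

open Classical in
/-- The length of a shortest walk from `a` to `b` with steps in `O`, or `k + 1` if there is no such
walk of length at most `k`. -/
noncomputable def cappedDist (O : ℕ → ℕ → Prop) (k a b : ℕ) : ℕ :=
  if h : ∃ ℓ, ℓ ≤ k ∧ Hops O ℓ a b then Nat.find h else k + 1

theorem Hops.of_cappedDist {O : ℕ → ℕ → Prop} {k a b : ℕ} (h : cappedDist O k a b ≤ k) :
    Hops O (cappedDist O k a b) a b := by
  classical
  unfold cappedDist at h ⊢
  split_ifs at h ⊢ with h'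
  · exact (Nat.find_spec h').2
  · omega

theorem cappedDist_le {O : ℕ → ℕ → Prop} {k ℓ a b : ℕ} (hℓ : ℓ ≤ k) (h : Hops O ℓ a b) :
    cappedDist O k a b ≤ ℓ := by
  classical
  unfold cappedDist
  rw [dif_pos ⟨ℓ, hℓ, h⟩]
  exact Nat.find_min' _ ⟨hℓ, h⟩

theorem cappedDist_le_succ (O : ℕ → ℕ → Prop) (k a b : ℕ) : cappedDist O k a b ≤ k + 1 := by
  by_cases h : ∃ ℓ, ℓ ≤ k ∧ Hops O ℓ a b
  · obtain ⟨ℓ, hℓ, h⟩ := h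
    exact (cappedDist_le hℓ h).trans (by omega)
  · unfold cappedDist
    rw [dif_neg h]

/-! ### Paths with fresh inner vertices -/

/-- The `j`-th vertex of a path of length `d` from `u` to `v` with inner vertices `b + 1, …`. -/
def pathVertex (u v b d j : ℕ) : ℕ := if j = 0 then u else if j = d then v else b + j

/-- The edges of a path of length `d` from `u` to `v` with inner vertices `b + 1, …`. -/
def pathPairs (u v b d : ℕ) : List (ℕ × ℕ) :=
  (List.range d).map fun j => (pathVertex u v b d j, pathVertex u v b d (j + 1))

/-- The block of `k` fresh vertices that is reserved for the pair `u, v`; the first `q` vertices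
are the terminals. -/
def block (q k u v : ℕ) : ℕ := q + (u * q + v) * k

/-- For every `u < v < q` at distance `D u v ≤ k`, a path of that length, with inner vertices in
the block of `u, v`. -/
def connectors (q k : ℕ) (D : ℕ → ℕ → ℕ) : List (ℕ × ℕ) :=
  (List.range q).flatMap fun u => (List.range q).flatMap fun v =>
    if u < v ∧ D u v ≤ k then pathPairs u v (block q k u v) (D u v) else []

/-- The edge from position `j` to position `j + 1` on the path for `u, v` is present. -/
structure OnPath (q k : ℕ) (D : ℕ → ℕ → ℕ) (u v j : ℕ) : Prop where
  lt : u < v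
  lt_q : v < q
  le_k : D u v ≤ k
  pos : j < D u v

theorem mem_connectors {q k : ℕ} {D : ℕ → ℕ → ℕ} {e : ℕ × ℕ} :
    e ∈ connectors q k D ↔ ∃ u v j, OnPath q k D u v j ∧
      e = (pathVertex u v (block q k u v) (D u v) j,
        pathVertex u v (block q k u v) (D u v) (j + 1)) := by
  simp only [connectors, List.mem_flatMap, List.mem_range]
  constructor
  · rintro ⟨u, -, v, hv, he⟩
    split_ifs at he with h
    · simp only [pathPairs, List.mem_map, List.mem_range] at he
      obtain ⟨j, hj, rfl⟩ := he
      exact ⟨u, v, j, ⟨h.1, hv, h.2, hj⟩, rfl⟩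
    · simp at he
  · rintro ⟨u, v, j, h, rfl⟩
    refine ⟨u, h.lt.trans h.lt_q, v, h.lt_q, ?_⟩
    rw [if_pos ⟨h.lt, h.le_k⟩]
    exact List.mem_map.2 ⟨j, List.mem_range.2 h.pos, rfl⟩

theorem block_separated {q k u v u' v' : ℕ} (hv : v < q) (hv' : v' < q) :
    (u = u' ∧ v = v') ∨ block q k u v + k ≤ block q k u' v' ∨
      block q k u' v' + k ≤ block q k u v := by
  have key : ∀ a b : ℕ, a < b → a * k + k ≤ b * k := fun a b h => by
    have := Nat.mul_le_mul_right k h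
    rwa [Nat.succ_mul] at this
  unfold block
  rcases lt_trichotomy (u * q + v) (u' * q + v') with h | h | h
  · have := key _ _ h
    omega
  · left
    have hq : 0 < q := by omega
    have h1 := congrArg (· / q) h
    have h2 := congrArg (· % q) h
    simp only [Nat.mul_comm _ q, Nat.mul_add_div hq, Nat.div_eq_of_lt hv, Nat.div_eq_of_lt hv',
      Nat.mul_add_mod, Nat.mod_eq_of_lt hv, Nat.mod_eq_of_lt hv'] at h1 h2
    exact ⟨h1, h2⟩
  · have := key _ _ h
    omega

theorem le_block (q k u v : ℕ) : q ≤ block q k u v := Nat.le_add_right _ _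

theorem block_add_le {q k u v : ℕ} (hu : u < q) (hv : v < q) :
    block q k u v + k ≤ q + q * q * k := by
  have h1 : u * q + v + 1 ≤ q * q := by
    have := Nat.mul_le_mul_right q hu
    rw [Nat.succ_mul] at this
    omega
  have h2 := Nat.mul_le_mul_right k h1
  rw [Nat.succ_mul] at h2
  unfold block
  omega

/-- An edge determines the path that it lies on and its position there. -/
theorem OnPath.eq_of_eq {q k : ℕ} {D : ℕ → ℕ → ℕ} {u v j u' v' j' : ℕ} (h : OnPath q k D u v j)
    (h' : OnPath q k D u' v' j')
    (he : s(pathVertex u v (block q k u v) (D u v) j,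
        pathVertex u v (block q k u v) (D u v) (j + 1)) =
      s(pathVertex u' v' (block q k u' v') (D u' v') j',
        pathVertex u' v' (block q k u' v') (D u' v') (j' + 1))) :
    u = u' ∧ v = v' ∧ j = j' := by
  obtain ⟨h1, h2, h3, h4⟩ := h
  obtain ⟨h1', h2', h3', h4'⟩ := h'
  have hb := le_block q k u v
  have hb' := le_block q k u' v'
  rcases block_separated (k := k) (u := u) (u' := u') h2 h2' with ⟨rfl, rfl⟩ | hs
  · refine ⟨rfl, rfl, ?_⟩
    generalize block q k u v = b at *
    generalize D u v = d at *
    simp only [pathVertex, Nat.succ_ne_zero, if_false] at he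
    rcases Sym2.eq_iff.1 he with ⟨e1, e2⟩ | ⟨e1, e2⟩ <;> split_ifs at e1 e2 <;> omega
  · generalize block q k u v = b at *
    generalize block q k u' v' = b' at *
    generalize D u v = d at *
    generalize D u' v' = d' at *
    simp only [pathVertex, Nat.succ_ne_zero, if_false] at he
    rcases Sym2.eq_iff.1 he with ⟨e1, e2⟩ | ⟨e1, e2⟩ <;> split_ifs at e1 e2 <;> omega

theorem connectors_nodup (q k : ℕ) (D : ℕ → ℕ → ℕ) :
    ((connectors q k D).map fun e => s(e.1, e.2)).Nodup := by
  have hmem : ∀ {u v : ℕ} {z : Sym2 ℕ}, v < q →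
      z ∈ (if u < v ∧ D u v ≤ k then pathPairs u v (block q k u v) (D u v) else []).map
        (fun e => s(e.1, e.2)) → ∃ j, OnPath q k D u v j ∧
          z = s(pathVertex u v (block q k u v) (D u v) j,
            pathVertex u v (block q k u v) (D u v) (j + 1)) := by
    intro u v z hv hz
    split_ifs at hz with h
    · simp only [pathPairs, List.map_map, List.mem_map, List.mem_range] at hz
      obtain ⟨j, hj, rfl⟩ := hz
      exact ⟨j, ⟨h.1, hv, h.2, hj⟩, rfl⟩
    · simp at hz
  rw [connectors, List.map_flatMap, List.nodup_flatMap]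
  constructor
  · intro u hu
    rw [List.map_flatMap, List.nodup_flatMap]
    constructor
    · intro v hv
      rw [List.mem_range] at hu hv
      split_ifs with h
      · rw [pathPairs, List.map_map]
        refine List.Nodup.map_on (fun j hj j' hj' he => ?_) List.nodup_range
        exact (OnPath.eq_of_eq ⟨h.1, hv, h.2, List.mem_range.1 hj⟩
          ⟨h.1, hv, h.2, List.mem_range.1 hj'⟩ he).2.2
      · simp
    · refine List.nodup_range.pairwise_of_forall_ne fun v hv v' hv' hne => ?_
      intro z hz hz'
      obtain ⟨j, h, rfl⟩ := hmem (List.mem_range.1 hv) hz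
      obtain ⟨j', h', he⟩ := hmem (List.mem_range.1 hv') hz'
      exact hne (h.eq_of_eq h' he).2.1
  · refine List.nodup_range.pairwise_of_forall_ne fun u hu u' hu' hne => ?_
    intro z hz hz'
    simp only [List.map_flatMap, List.mem_flatMap] at hz hz'
    obtain ⟨v, hv, hz⟩ := hz
    obtain ⟨v', hv', hz'⟩ := hz'
    obtain ⟨j, h, rfl⟩ := hmem (List.mem_range.1 hv) hz
    obtain ⟨j', h', he⟩ := hmem (List.mem_range.1 hv') hz'
    exact hne (h.eq_of_eq h' he).1

theorem length_connectors_le (q k : ℕ) (D : ℕ → ℕ → ℕ) :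
    (connectors q k D).length ≤ q * q * k := by
  have aux : ∀ (f : ℕ → List (ℕ × ℕ)) (B q : ℕ), (∀ i, (f i).length ≤ B) →
      ((List.range q).flatMap f).length ≤ q * B := by
    intro f B q hf
    induction q with
    | zero => simp
    | succ q ih =>
      rw [List.range_succ, List.flatMap_append, List.length_append, Nat.succ_mul]
      simpa using Nat.add_le_add ih (hf q)
  rw [Nat.mul_assoc]
  refine aux _ _ _ fun u => aux _ _ _ fun v => ?_
  split_ifs with h
  · simpa [pathPairs] using h.2
  · simp

end SPFG

namespace SPFG

open Relation

/-! ### The kernel -/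

namespace Raw

variable (R : Raw)

/-- The surviving forcing edges. -/
def keptPairs : List (ℕ × ℕ) := kept R.k R.F

/-- The relevant edges: those on which a surviving forcing edge is incident. -/
def rel : List ℕ := number (flat R.keptPairs)

/-- The steps along edges that are not relevant. -/
def Free : ℕ → ℕ → Prop := Outside R.E R.rel.toFinset

/-- The terminals: `s`, `t` and the ends of the relevant edges. -/
def term : List ℕ := number (R.s :: R.t :: flat (R.rel.map fun i => R.E.getD i (0, 0)))

/-- The capped distance of two terminals along edges that are not relevant. -/
noncomputable def termDist (u v : ℕ) : ℕ :=
  cappedDist R.Free R.k (R.term.getD u 0) (R.term.getD v 0)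

/-- The relevant edges, between renumbered terminals. -/
def relPairs : List (ℕ × ℕ) := R.rel.map fun i =>
  (R.term.idxOf (R.E.getD i (0, 0)).1, R.term.idxOf (R.E.getD i (0, 0)).2)

/-- The kernel: the vertices are the terminals, numbered from `0`, and a block of `k` fresh vertices
for each pair of terminals (some of them remain isolated); the edges are the relevant edges and the
paths that replace shortest free walks; the forcing edges are the surviving ones. -/
noncomputable def kernel : Raw where
  n := R.term.length + R.term.length * R.term.length * R.k
  E := R.relPairs ++ connectors R.term.length R.k R.termDist
  F := R.keptPairs.map fun f => (R.rel.idxOf f.1, R.rel.idxOf f.2)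
  s := 0
  t := 1
  k := R.k

theorem length_relPairs : R.relPairs.length = R.rel.length := by simp [relPairs]

theorem mem_rel_of_mem {f : ℕ × ℕ} (hf : f ∈ R.keptPairs) : f.1 ∈ R.rel ∧ f.2 ∈ R.rel :=
  ⟨mem_number.2 (mem_flat.2 ⟨f, hf, .inl rfl⟩), mem_number.2 (mem_flat.2 ⟨f, hf, .inr rfl⟩)⟩

theorem mem_term_of_mem_rel {i : ℕ} (hi : i ∈ R.rel) :
    (R.E.getD i (0, 0)).1 ∈ R.term ∧ (R.E.getD i (0, 0)).2 ∈ R.term := by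
  constructor <;>
  · simp only [term, mem_number, List.mem_cons, mem_flat, List.mem_map]
    exact .inr (.inr ⟨_, ⟨i, hi, rfl⟩, by simp⟩)

variable {R}

theorem length_rel_le : R.rel.length ≤ 2 * (R.k * (R.k + 1) + 1) := by
  refine (length_number_le _).trans ?_
  rw [length_flat]
  exact Nat.mul_le_mul_left _ (length_kept_le _ _)

theorem length_term_le : R.term.length ≤ 2 * R.rel.length + 2 := by
  refine (length_number_le _).trans ?_
  simp [length_flat]

theorem term_zero_one (h : R.s ≠ R.t) :
    R.term.getD 0 0 = R.s ∧ R.term.getD 1 0 = R.t ∧ 2 ≤ R.term.length := by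
  have hp := prefix_number_append [R.s, R.t] (flat (R.rel.map fun i => R.E.getD i (0, 0)))
  have h2 : number [R.s, R.t] = [R.s, R.t] := by simp [number, addNew, Ne.symm h]
  rw [h2] at hp
  obtain ⟨L, hL⟩ := hp
  have : R.term = R.s :: R.t :: L := hL.symm
  simp [this]

namespace Valid

variable (h : R.Valid)
include h

theorem rel_lt {i : ℕ} (hi : i ∈ R.rel) : i < R.E.length := by
  obtain ⟨f, hf, hi⟩ := mem_flat.1 (mem_number.1 hi)
  have hf' := (kept_sublist _ _).subset hf
  rcases hi with rfl | rfl
  · exact h.F.lt_left _ hf'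
  · exact h.F.lt_right _ hf'

theorem joins_of_mem_rel {i : ℕ} (hi : i ∈ R.rel) :
    R.E[i]? = some (R.E.getD i (0, 0)) := by
  rw [List.getD_eq_getElem _ _ (h.rel_lt hi), List.getElem?_eq_getElem (h.rel_lt hi)]

theorem getD_mem_of_mem_rel {i : ℕ} (hi : i ∈ R.rel) : R.E.getD i (0, 0) ∈ R.E :=
  List.mem_of_getElem? (h.joins_of_mem_rel hi)

theorem term_lt {v : ℕ} (hv : v ∈ R.s :: R.t :: flat (R.rel.map fun i => R.E.getD i (0, 0))) :
    v < R.n := by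
  simp only [List.mem_cons, mem_flat, List.mem_map] at hv
  rcases hv with rfl | rfl | ⟨_, ⟨i, hi, rfl⟩, rfl | rfl⟩
  · exact h.s_lt
  · exact h.t_lt
  · exact h.E.lt_left _ (h.getD_mem_of_mem_rel hi)
  · exact h.E.lt_right _ (h.getD_mem_of_mem_rel hi)

/-- An edge of the graph is found at one position only. -/
theorem joins_unique {i j x y : ℕ} (hi : Joins R.E i x y) (hj : Joins R.E j x y) : i = j := by
  have aux : ∀ {i : ℕ}, Joins R.E i x y →
      (R.E.map fun e => s(e.1, e.2))[i]? = some s(x, y) := by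
    intro i hi
    rcases hi with hi | hi <;> simp [hi, Sym2.eq_swap]
  have hlt : i < (R.E.map fun e => s(e.1, e.2)).length := by
    by_contra hlt
    have := aux hi
    rw [List.getElem?_eq_none (not_lt.1 hlt)] at this
    simp at this
  exact (List.getElem?_inj hlt h.E.nodup).1 ((aux hi).trans (aux hj).symm)

omit h in
theorem relPairs_lt {e : ℕ × ℕ} (he : e ∈ R.relPairs) :
    e.1 < R.term.length ∧ e.2 < R.term.length := by
  obtain ⟨i, hi, rfl⟩ := List.mem_map.1 he
  exact ⟨List.idxOf_lt_length_of_mem (R.mem_term_of_mem_rel hi).1,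
    List.idxOf_lt_length_of_mem (R.mem_term_of_mem_rel hi).2⟩

/-- Renumbering the terminals keeps relevant edges apart. -/
theorem eq_of_idxOf_eq {i j : ℕ} (hi : i ∈ R.rel) (hj : j ∈ R.rel)
    (he : s(R.term.idxOf (R.E.getD i (0, 0)).1, R.term.idxOf (R.E.getD i (0, 0)).2) =
      s(R.term.idxOf (R.E.getD j (0, 0)).1, R.term.idxOf (R.E.getD j (0, 0)).2)) : i = j := by
  have he' := congrArg (Sym2.map fun a => R.term.getD a 0) he
  simp only [Sym2.map_mk, getD_idxOf (R.mem_term_of_mem_rel hi).1,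
    getD_idxOf (R.mem_term_of_mem_rel hi).2, getD_idxOf (R.mem_term_of_mem_rel hj).1,
    getD_idxOf (R.mem_term_of_mem_rel hj).2] at he'
  refine h.joins_unique (x := (R.E.getD i (0, 0)).1) (y := (R.E.getD i (0, 0)).2)
    (.inl (h.joins_of_mem_rel hi)) ?_
  rcases Sym2.eq_iff.1 he' with ⟨h1, h2⟩ | ⟨h1, h2⟩
  · rw [h1, h2]
    exact .inl (h.joins_of_mem_rel hj)
  · rw [h1, h2]
    exact .inr (h.joins_of_mem_rel hj)

theorem kernel_E : SimplePairs R.kernel.n R.kernel.E := by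
  have hterm : R.term.length ≤ R.kernel.n := Nat.le_add_right _ _
  have hpath : ∀ {u v j i : ℕ}, OnPath R.term.length R.k R.termDist u v j → i ≤ R.termDist u v →
      pathVertex u v (block R.term.length R.k u v) (R.termDist u v) i < R.kernel.n := by
    intro u v j i hp hi
    have h1 := hp.lt
    have h2 := hp.lt_q
    have h3 := hp.le_k
    have h4 := block_add_le (k := R.k) (h1.trans h2) h2
    have h5 : R.kernel.n = R.term.length + R.term.length * R.term.length * R.k := rfl
    unfold pathVertex
    split_ifs <;> omega
  refine ⟨fun e he => ?_, fun e he => ?_, fun e he => ?_, ?_⟩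
  · rcases List.mem_append.1 he with he | he
    · exact (relPairs_lt he).1.trans_le hterm
    · obtain ⟨u, v, j, hp, rfl⟩ := mem_connectors.1 he
      exact hpath hp hp.pos.le
  · rcases List.mem_append.1 he with he | he
    · exact (relPairs_lt he).2.trans_le hterm
    · obtain ⟨u, v, j, hp, rfl⟩ := mem_connectors.1 he
      exact hpath hp hp.pos
  · rcases List.mem_append.1 he with he | he
    · obtain ⟨i, hi, rfl⟩ := List.mem_map.1 he
      intro heq
      have := congrArg (fun a => R.term.getD a 0) heq
      simp only [getD_idxOf (R.mem_term_of_mem_rel hi).1,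
        getD_idxOf (R.mem_term_of_mem_rel hi).2] at this
      exact h.E.ne _ (h.getD_mem_of_mem_rel hi) this
    · obtain ⟨u, v, j, ⟨h1, h2, h3, h4⟩, rfl⟩ := mem_connectors.1 he
      have := le_block R.term.length R.k u v
      simp only [pathVertex, Nat.succ_ne_zero, if_false]
      split_ifs <;> omega
  · change ((R.relPairs ++ connectors R.term.length R.k R.termDist).map fun e => s(e.1, e.2)).Nodup
    rw [List.map_append]
    refine List.Nodup.append ?_ (connectors_nodup _ _ _) ?_
    · rw [relPairs, List.map_map]
      exact (number_nodup _).map_on fun i hi j hj he => h.eq_of_idxOf_eq hi hj he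
    · -- a path of length one is an edge that is not relevant, longer paths have fresh vertices
      intro z hz hz'
      rw [List.mem_map] at hz hz'
      obtain ⟨e, he, rfl⟩ := hz
      obtain ⟨e', he', hee⟩ := hz'
      obtain ⟨u, v, j, ⟨h1, h2, h3, h4⟩, rfl⟩ := mem_connectors.1 he'
      have hlt := relPairs_lt he
      have hb := le_block R.term.length R.k u v
      have key : R.termDist u v = 1 ∧ ((u = e.1 ∧ v = e.2) ∨ (u = e.2 ∧ v = e.1)) := by
        simp only [pathVertex, Nat.succ_ne_zero, if_false] at hee
        rcases Sym2.eq_iff.1 hee with ⟨e1, e2⟩ | ⟨e1, e2⟩ <;> split_ifs at e1 e2 <;> omega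
      obtain ⟨hd, huv⟩ := key
      have hops : Hops R.Free (R.termDist u v) _ _ := Hops.of_cappedDist h3
      rw [hd] at hops
      obtain ⟨w, hw, i, hi, hij⟩ := hops_succ.1 hops
      rw [← hops_zero.1 hw] at hij
      obtain ⟨a, ha, rfl⟩ := List.mem_map.1 he
      have hja : Joins R.E a (R.term.getD u 0) (R.term.getD v 0) := by
        rcases huv with ⟨rfl, rfl⟩ | ⟨rfl, rfl⟩
        · rw [getD_idxOf (R.mem_term_of_mem_rel ha).1, getD_idxOf (R.mem_term_of_mem_rel ha).2]
          exact .inl (h.joins_of_mem_rel ha)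
        · rw [getD_idxOf (R.mem_term_of_mem_rel ha).1, getD_idxOf (R.mem_term_of_mem_rel ha).2]
          exact .inr (h.joins_of_mem_rel ha)
      rw [h.joins_unique hij hja] at hi
      exact hi (List.mem_toFinset.2 ha)

theorem kernel_F : SimplePairs R.kernel.E.length R.kernel.F := by
  have hlen : R.rel.length ≤ R.kernel.E.length := by
    simp only [kernel, List.length_append, length_relPairs]
    omega
  have hmem : ∀ {e : ℕ × ℕ}, e ∈ R.kernel.F → ∃ f ∈ R.keptPairs,
      (R.rel.idxOf f.1, R.rel.idxOf f.2) = e := fun he => List.mem_map.1 he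
  have hget : ∀ f ∈ R.keptPairs, R.rel.getD (R.rel.idxOf f.1) 0 = f.1 ∧
      R.rel.getD (R.rel.idxOf f.2) 0 = f.2 := fun f hf =>
    ⟨getD_idxOf (R.mem_rel_of_mem hf).1, getD_idxOf (R.mem_rel_of_mem hf).2⟩
  have hsub : R.keptPairs.Sublist R.F := kept_sublist _ _
  refine ⟨fun e he => ?_, fun e he => ?_, fun e he => ?_, ?_⟩
  · obtain ⟨f, hf, rfl⟩ := hmem he
    exact (List.idxOf_lt_length_of_mem (R.mem_rel_of_mem hf).1).trans_le hlen
  · obtain ⟨f, hf, rfl⟩ := hmem he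
    exact (List.idxOf_lt_length_of_mem (R.mem_rel_of_mem hf).2).trans_le hlen
  · obtain ⟨f, hf, rfl⟩ := hmem he
    intro heq
    have := congrArg (fun a => R.rel.getD a 0) heq
    simp only [hget f hf] at this
    exact h.F.ne f (hsub.subset hf) this
  · simp only [kernel, List.map_map]
    have hnd := h.F.nodup.sublist (hsub.map _)
    refine List.Nodup.of_map (Sym2.map fun a => R.rel.getD a 0) ?_
    rw [List.map_map]
    refine (List.map_congr_left fun f hf => ?_) ▸ hnd
    simp only [Function.comp, Sym2.map_mk, hget f hf]

theorem kernel : R.kernel.Valid := by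
  have h2 := (term_zero_one h.s_ne_t).2.2
  have h3 : R.term.length ≤ R.kernel.n := Nat.le_add_right _ _
  exact ⟨h.kernel_E, h.kernel_F, by change 0 < _; omega, by change 1 < _; omega,
    Nat.zero_ne_one, h.k_pos⟩

/-! ### The kernel is equivalent -/

omit h in
/-- The steps in the kernel outside the relevant edges are the steps on the inserted paths. -/
theorem outside_kernel_iff {x y : ℕ} :
    Outside R.kernel.E (Finset.range R.rel.length) x y ↔
      (x, y) ∈ connectors R.term.length R.k R.termDist ∨
        (y, x) ∈ connectors R.term.length R.k R.termDist := by
  have aux : ∀ e : ℕ × ℕ, (∃ i ∉ Finset.range R.rel.length, R.kernel.E[i]? = some e) ↔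
      e ∈ connectors R.term.length R.k R.termDist := by
    intro e
    simp only [Finset.mem_range, not_lt, Raw.kernel, ← length_relPairs, List.mem_iff_getElem?]
    constructor
    · rintro ⟨i, hi, h⟩
      exact ⟨_, by rwa [List.getElem?_append_right hi] at h⟩
    · rintro ⟨i, h⟩
      refine ⟨R.relPairs.length + i, by omega, ?_⟩
      rw [List.getElem?_append_right (by omega), Nat.add_sub_cancel_left, h]
  rw [← aux, ← aux]
  simp only [Outside, Joins]
  constructor
  · rintro ⟨i, hi, h | h⟩
    · exact .inl ⟨i, hi, h⟩
    · exact .inr ⟨i, hi, h⟩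
  · rintro (⟨i, hi, h⟩ | ⟨i, hi, h⟩)
    · exact ⟨i, hi, .inl h⟩
    · exact ⟨i, hi, .inr h⟩

omit h in
theorem kernel_getElem? {i : ℕ} (hi : i < R.rel.length) :
    R.kernel.E[i]? = some (R.term.idxOf (R.E.getD (R.rel.getD i 0) (0, 0)).1,
      R.term.idxOf (R.E.getD (R.rel.getD i 0) (0, 0)).2) := by
  simp only [Raw.kernel]
  rw [List.getElem?_append_left (by rwa [length_relPairs]), relPairs, List.getElem?_map,
    List.getElem?_eq_getElem hi, List.getD_eq_getElem _ _ hi]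
  rfl

theorem along_kernel_of_along {A : Finset ℕ} (hA : A ⊆ R.rel.toFinset) {x y : ℕ}
    (hxy : Along R.E A x y) : x ∈ R.term ∧ y ∈ R.term ∧
      Along R.kernel.E (A.image fun i => R.rel.idxOf i) (R.term.idxOf x) (R.term.idxOf y) := by
  obtain ⟨i, hi, hj⟩ := hxy
  have hi' : i ∈ R.rel := List.mem_toFinset.1 (hA hi)
  have h1 := kernel_getElem? (List.idxOf_lt_length_of_mem hi')
  have h2 := R.mem_term_of_mem_rel hi'
  rw [getD_idxOf hi'] at h1
  simp only [Joins, h.joins_of_mem_rel hi', Option.some.injEq] at hj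
  rcases hj with hj | hj <;> rw [hj] at h1 h2
  · exact ⟨h2.1, h2.2, _, Finset.mem_image_of_mem _ hi, .inl h1⟩
  · exact ⟨h2.2, h2.1, _, Finset.mem_image_of_mem _ hi, .inr h1⟩

theorem along_of_along_kernel {A : Finset ℕ} (hA : A ⊆ Finset.range R.rel.length) {x y : ℕ}
    (hxy : Along R.kernel.E A x y) : x < R.term.length ∧ y < R.term.length ∧
      Along R.E (A.image fun i => R.rel.getD i 0) (R.term.getD x 0) (R.term.getD y 0) := by
  obtain ⟨i, hi, hj⟩ := hxy
  have hi' : i < R.rel.length := Finset.mem_range.1 (hA hi)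
  have hr := getD_mem hi'
  have h2 := R.mem_term_of_mem_rel hr
  have h3 := h.joins_of_mem_rel hr
  simp only [Joins, kernel_getElem? hi', Option.some.injEq, Prod.mk.injEq] at hj
  rcases hj with ⟨rfl, rfl⟩ | ⟨rfl, rfl⟩
  · refine ⟨List.idxOf_lt_length_of_mem h2.1, List.idxOf_lt_length_of_mem h2.2, _,
      Finset.mem_image_of_mem _ hi, .inl ?_⟩
    rw [getD_idxOf h2.1, getD_idxOf h2.2, h3]
  · refine ⟨List.idxOf_lt_length_of_mem h2.2, List.idxOf_lt_length_of_mem h2.1, _,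
      Finset.mem_image_of_mem _ hi, .inr ?_⟩
    rw [getD_idxOf h2.1, getD_idxOf h2.2, h3]

omit h in
/-- The inserted paths can be walked in both directions. -/
theorem wReach_path {Z : ℕ → ℕ → Prop} {u v : ℕ} (huv : u < v) (hv : v < R.term.length)
    (hd : R.termDist u v ≤ R.k) (hpos : 0 < R.termDist u v) :
    WReach Z (Outside R.kernel.E (Finset.range R.rel.length)) u (R.termDist u v) v ∧
      WReach Z (Outside R.kernel.E (Finset.range R.rel.length)) v (R.termDist u v) u := by
  set b := block R.term.length R.k u v with hb
  have hstep : ∀ j < R.termDist u v, Outside R.kernel.E (Finset.range R.rel.length)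
      (pathVertex u v b (R.termDist u v) j) (pathVertex u v b (R.termDist u v) (j + 1)) :=
    fun j hj => outside_kernel_iff.2 (.inl (mem_connectors.2 ⟨u, v, j, ⟨huv, hv, hd, hj⟩, rfl⟩))
  have h0 : pathVertex u v b (R.termDist u v) 0 = u := by simp [pathVertex]
  have h1 : pathVertex u v b (R.termDist u v) (R.termDist u v) = v := by
    simp [pathVertex, hpos.ne']
  constructor
  · have : ∀ j ≤ R.termDist u v, Hops (Outside R.kernel.E (Finset.range R.rel.length)) j u
        (pathVertex u v b (R.termDist u v) j) := by
      intro j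
      induction j with
      | zero => exact fun _ => h0.symm ▸ Hops.zero u
      | succ j ih => exact fun hj => (ih (by omega)).succ (hstep j hj)
    have := this _ le_rfl
    rw [h1] at this
    exact this.wReach
  · have : ∀ j ≤ R.termDist u v, Hops (Outside R.kernel.E (Finset.range R.rel.length)) j v
        (pathVertex u v b (R.termDist u v) (R.termDist u v - j)) := by
      intro j
      induction j with
      | zero => exact fun _ => h1.symm ▸ Hops.zero v
      | succ j ih =>
        intro hj
        refine (ih (by omega)).succ ?_
        have := (hstep (R.termDist u v - (j + 1)) (by omega)).symm
        rwa [show R.termDist u v - (j + 1) + 1 = R.termDist u v - j by omega] at this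
    have := this _ le_rfl
    rw [Nat.sub_self, h0] at this
    exact this.wReach

omit h in
/-- A free walk between two terminals is at least as long as the path inserted for them. -/
theorem exists_wReach_of_hops {Z : ℕ → ℕ → Prop} {u v ℓ : ℕ} (hu : u < R.term.length)
    (hv : v < R.term.length) (hℓ : ℓ ≤ R.k)
    (hops : Hops R.Free ℓ (R.term.getD u 0) (R.term.getD v 0)) :
    ∃ c ≤ ℓ, WReach Z (Outside R.kernel.E (Finset.range R.rel.length)) u c v := by
  have hne : ∀ {u v : ℕ}, u < v → v < R.term.length → R.termDist u v ≤ R.k →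
      0 < R.termDist u v := by
    intro u v huv hv hd
    by_contra h0
    have : Hops R.Free (R.termDist u v) _ _ := Hops.of_cappedDist hd
    rw [Nat.eq_zero_of_not_pos h0] at this
    have hnd : R.term.Nodup := number_nodup _
    have h1 := idxOf_getD hnd (huv.trans hv)
    rw [hops_zero.1 this, idxOf_getD hnd hv] at h1
    omega
  rcases lt_trichotomy u v with huv | rfl | huv
  · have hle : R.termDist u v ≤ ℓ := cappedDist_le hℓ hops
    exact ⟨_, hle, (wReach_path huv hv (hle.trans hℓ) (hne huv hv (hle.trans hℓ))).1⟩
  · exact ⟨0, Nat.zero_le _, .refl⟩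
  · have hle : R.termDist v u ≤ ℓ := cappedDist_le hℓ (hops.symm fun _ _ => Outside.symm)
    exact ⟨_, hle, (wReach_path huv hu (hle.trans hℓ) (hne huv hu (hle.trans hℓ))).2⟩

/-- A walk in the original graph is followed in the kernel up to the last terminal; the rest of the
walk is free. -/
theorem follow_in_kernel {A : Finset ℕ} (hA : A ⊆ R.rel.toFinset) {c x : ℕ} (hc : c ≤ R.k)
    (hw : WReach (Along R.E A) R.Free R.s c x) :
    ∃ i < R.term.length, ∃ c₁ ℓ, c₁ + ℓ ≤ c ∧
      WReach (Along R.kernel.E (A.image fun i => R.rel.idxOf i))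
        (Outside R.kernel.E (Finset.range R.rel.length)) 0 c₁ i ∧
      Hops R.Free ℓ (R.term.getD i 0) x := by
  obtain ⟨hs, -, h2⟩ := term_zero_one h.s_ne_t
  induction hw with
  | refl => exact ⟨0, by omega, 0, 0, le_rfl, .refl, hs ▸ Hops.zero _⟩
  | zero _ hz ih =>
    obtain ⟨i, hi, c₁, ℓ, hle, hw, hops⟩ := ih hc
    obtain ⟨hx, hy, ha⟩ := h.along_kernel_of_along hA hz
    have hx' := List.idxOf_lt_length_of_mem hx
    rw [← getD_idxOf hx] at hops
    obtain ⟨c₂, hc₂, hw₂⟩ := exists_wReach_of_hops hi hx' (by omega) hops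
    refine ⟨_, List.idxOf_lt_length_of_mem hy, c₁ + c₂, 0, by omega, (hw.trans hw₂).zero ha, ?_⟩
    rw [getD_idxOf hy]
    exact Hops.zero _
  | one _ ho ih =>
    obtain ⟨i, hi, c₁, ℓ, hle, hw, hops⟩ := ih (by omega)
    exact ⟨i, hi, c₁, ℓ + 1, by omega, hw, hops.succ ho⟩

/-- Position `j` on the path for `u, v` can be reached at cost `c` from one of the two ends. -/
def PathReach (Z O : ℕ → ℕ → Prop) (T : List ℕ) (s d u v j c : ℕ) : Prop :=
  (∃ c₀, c₀ + j ≤ c ∧ WReach Z O s c₀ (T.getD u 0)) ∨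
    ∃ c₀, c₀ + (d - j) ≤ c ∧ WReach Z O s c₀ (T.getD v 0)

/-- A walk in the kernel is followed in the original graph; on an inserted path, only the two ends
of this path are known to be reached. -/
theorem follow_in_original {A : Finset ℕ} (hA : A ⊆ Finset.range R.rel.length) {c x : ℕ}
    (hw : WReach (Along R.kernel.E A)
      (Outside R.kernel.E (Finset.range R.rel.length)) 0 c x) :
    (x < R.term.length → ∃ c₀ ≤ c, WReach (Along R.E (A.image fun i => R.rel.getD i 0)) R.Free
      R.s c₀ (R.term.getD x 0)) ∧
    ∀ u v j, OnPath R.term.length R.k R.termDist u v j → 0 < j →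
      x = block R.term.length R.k u v + j →
      PathReach (Along R.E (A.image fun i => R.rel.getD i 0)) R.Free R.term R.s
        (R.termDist u v) u v j c := by
  obtain ⟨hs, -, h2⟩ := term_zero_one h.s_ne_t
  have hfree : ∀ x y, R.Free x y → R.Free y x := fun _ _ => Outside.symm
  induction hw with
  | refl =>
    refine ⟨fun _ => ⟨0, le_rfl, hs ▸ .refl⟩, fun u v j hp hj hx => ?_⟩
    have := le_block R.term.length R.k u v
    omega
  | zero _ hz ih =>
    obtain ⟨hx, hy, ha⟩ := h.along_of_along_kernel hA hz
    refine ⟨fun _ => ?_, fun u v j hp hj hy' => ?_⟩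
    · obtain ⟨c₀, hc₀, hw⟩ := ih.1 hx
      exact ⟨c₀, hc₀, hw.zero ha⟩
    · have := le_block R.term.length R.k u v
      omega
  | one _ ho ih =>
    rename_i c x y _
    -- position `j` of a path is a terminal or a fresh vertex; both are handled alike
    have enter : ∀ {u v i j : ℕ}, OnPath R.term.length R.k R.termDist u v i →
        j ≤ R.termDist u v →
        x = pathVertex u v (block R.term.length R.k u v) (R.termDist u v) j →
        PathReach (Along R.E (A.image fun i => R.rel.getD i 0)) R.Free R.term R.s
          (R.termDist u v) u v j c := by
      intro u v i j hp hj hx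
      unfold pathVertex at hx
      split_ifs at hx with h0 h1
      · obtain ⟨c₀, hc₀, hw⟩ := ih.1 (hx ▸ hp.lt.trans hp.lt_q)
        exact .inl ⟨c₀, by omega, hx ▸ hw⟩
      · obtain ⟨c₀, hc₀, hw⟩ := ih.1 (hx ▸ hp.lt_q)
        exact .inr ⟨c₀, by omega, hx ▸ hw⟩
      · exact ih.2 u v j ⟨hp.lt, hp.lt_q, hp.le_k, by omega⟩ (by omega) hx
    have leave : ∀ {u v i j : ℕ}, OnPath R.term.length R.k R.termDist u v i →
        j ≤ R.termDist u v →
        PathReach (Along R.E (A.image fun i => R.rel.getD i 0)) R.Free R.term R.s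
          (R.termDist u v) u v j (c + 1) →
        y = pathVertex u v (block R.term.length R.k u v) (R.termDist u v) j →
        (y < R.term.length → ∃ c₀ ≤ c + 1,
          WReach (Along R.E (A.image fun i => R.rel.getD i 0)) R.Free R.s c₀ (R.term.getD y 0)) ∧
        ∀ u v j, OnPath R.term.length R.k R.termDist u v j → 0 < j →
          y = block R.term.length R.k u v + j →
          PathReach (Along R.E (A.image fun i => R.rel.getD i 0)) R.Free R.term R.s
            (R.termDist u v) u v j (c + 1) := by
      intro u v i j hp hj hr hy
      have hd : Hops R.Free (R.termDist u v) _ _ := Hops.of_cappedDist hp.le_k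
      have hb := le_block R.term.length R.k u v
      have hlt := hp.lt
      have hltq := hp.lt_q
      have hlek := hp.le_k
      unfold pathVertex at hy
      split_ifs at hy with h0 h1
      · subst hy
        refine ⟨fun _ => ?_, fun u' v' j' hp' hj' hx' => ?_⟩
        · rcases hr with ⟨c₀, hc₀, hw⟩ | ⟨c₀, hc₀, hw⟩
          · exact ⟨c₀, by omega, hw⟩
          · exact ⟨_, by omega, hw.trans (hd.symm hfree).wReach⟩
        · have := le_block R.term.length R.k u' v'
          omega
      · subst hy
        refine ⟨fun _ => ?_, fun u' v' j' hp' hj' hx' => ?_⟩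
        · rcases hr with ⟨c₀, hc₀, hw⟩ | ⟨c₀, hc₀, hw⟩
          · exact ⟨_, by omega, hw.trans hd.wReach⟩
          · exact ⟨c₀, by omega, hw⟩
        · have := le_block R.term.length R.k u' v'
          omega
      · refine ⟨fun hlt => by omega, fun u' v' j' hp' hj' hx' => ?_⟩
        have hp1 := hp'.pos
        have hp2 := hp'.le_k
        rcases block_separated (k := R.k) (u := u) (u' := u') hltq hp'.lt_q with
          ⟨rfl, rfl⟩ | hs
        · have : j' = j := by omega
          exact this ▸ hr
        · omega
    rcases outside_kernel_iff.1 ho with he | he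
    · obtain ⟨u, v, j, hp, he⟩ := mem_connectors.1 he
      obtain ⟨hx, hy⟩ := Prod.mk.inj he
      have hpos := hp.pos
      refine leave hp hp.pos ?_ hy
      rcases enter hp hpos.le hx with ⟨c₀, hc₀, hw⟩ | ⟨c₀, hc₀, hw⟩
      · exact .inl ⟨c₀, by omega, hw⟩
      · exact .inr ⟨c₀, by omega, hw⟩
    · obtain ⟨u, v, j, hp, he⟩ := mem_connectors.1 he
      obtain ⟨hy, hx⟩ := Prod.mk.inj he
      have hpos := hp.pos
      refine leave hp hpos.le ?_ hy
      rcases enter hp hp.pos hx with ⟨c₀, hc₀, hw⟩ | ⟨c₀, hc₀, hw⟩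
      · exact .inl ⟨c₀, by omega, hw⟩
      · exact .inr ⟨c₀, by omega, hw⟩

theorem isYes_kernel_iff : R.kernel.IsYes ↔ R.IsYes := by
  classical
  have hkept : R.IsYes ↔ Raw.IsYes { R with F := R.keptPairs } := by
    constructor
    · rintro ⟨S, h1, h2, h3⟩
      exact ⟨S, h1, fun f hf => h2 f ((kept_sublist _ _).subset hf), h3⟩
    · rintro ⟨S, h1, h2, h3⟩
      exact ⟨S, h1, h2.of_kept h.F.nodup h1, h3⟩
  obtain ⟨hs, ht, h2⟩ := term_zero_one h.s_ne_t
  rw [hkept, R.kernel.isYes_iff_wReach (Finset.range R.rel.length),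
    Raw.isYes_iff_wReach { R with F := R.keptPairs } R.rel.toFinset]
  · constructor
    · rintro ⟨A, hA, hcov, c, hc, hw⟩
      obtain ⟨c₀, hc₀, hw₀⟩ := (h.follow_in_original hA hw).1 (by change 1 < _; omega)
      refine ⟨A.image fun i => R.rel.getD i 0, fun a ha => ?_, fun f hf => ?_, c₀, ?_, ?_⟩
      · obtain ⟨i, hi, rfl⟩ := Finset.mem_image.1 ha
        exact List.mem_toFinset.2 (getD_mem (Finset.mem_range.1 (hA hi)))
      · have hmem := R.mem_rel_of_mem hf
        refine (hcov _ (List.mem_map.2 ⟨f, hf, rfl⟩)).imp (fun hi => ?_) fun hi => ?_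
        · exact Finset.mem_image.2 ⟨_, hi, getD_idxOf hmem.1⟩
        · exact Finset.mem_image.2 ⟨_, hi, getD_idxOf hmem.2⟩
      · have := Finset.card_image_le (s := A) (f := fun i => R.rel.getD i 0)
        have : R.kernel.k = R.k := rfl
        change _ ≤ R.k
        omega
      · change WReach _ R.Free R.s c₀ R.t
        rw [← ht]
        exact hw₀
    · rintro ⟨A, hA, hcov, c, hc, hw⟩
      have hck : c ≤ R.k := le_trans (Nat.le_add_left _ _) hc
      obtain ⟨i, hi, c₁, ℓ, hle, hw₁, hops⟩ := h.follow_in_kernel hA hck hw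
      obtain ⟨c₂, hc₂, hw₂⟩ := exists_wReach_of_hops (v := 1) (ℓ := ℓ) hi (by omega) (by omega)
        (by rw [ht]; exact hops)
      refine ⟨A.image fun i => R.rel.idxOf i, fun a ha => ?_, fun f hf => ?_, c₁ + c₂, ?_,
        hw₁.trans hw₂⟩
      · obtain ⟨i, hi, rfl⟩ := Finset.mem_image.1 ha
        exact Finset.mem_range.2 (List.idxOf_lt_length_of_mem (List.mem_toFinset.1 (hA hi)))
      · obtain ⟨g, hg, rfl⟩ := List.mem_map.1 hf
        exact (hcov g hg).imp (fun hi => Finset.mem_image_of_mem _ hi)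
          fun hi => Finset.mem_image_of_mem _ hi
      · have := Finset.card_image_le (s := A) (f := fun i => R.rel.idxOf i)
        change _ ≤ R.k
        change A.card + c ≤ R.k at hc
        omega
  · exact fun f hf => ⟨List.mem_toFinset.2 (R.mem_rel_of_mem hf).1,
      List.mem_toFinset.2 (R.mem_rel_of_mem hf).2⟩
  · intro f hf
    obtain ⟨g, hg, rfl⟩ := List.mem_map.1 hf
    exact ⟨Finset.mem_range.2 (List.idxOf_lt_length_of_mem (R.mem_rel_of_mem hg).1),
      Finset.mem_range.2 (List.idxOf_lt_length_of_mem (R.mem_rel_of_mem hg).2)⟩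

end Valid

/-! ### The size of the kernel -/

theorem kernel_bounds (hk : 0 < R.k) :
    R.kernel.n ≤ 210 * R.k ^ 5 ∧ R.kernel.E.length ≤ 210 * R.k ^ 5 ∧
      R.kernel.F.length ≤ 3 * R.k ^ 5 := by
  have hE : R.kernel.E.length ≤ R.rel.length + R.term.length * R.term.length * R.k := by
    simp only [kernel, List.length_append, length_relPairs]
    have := length_connectors_le R.term.length R.k R.termDist
    omega
  have hF : R.kernel.F.length ≤ R.k * (R.k + 1) + 1 := by
    simp only [kernel, List.length_map]
    exact length_kept_le _ _
  have hn : R.kernel.n = R.term.length + R.term.length * R.term.length * R.k := rfl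
  have h1 := length_rel_le (R := R)
  have h2 := length_term_le (R := R)
  -- `3 k²` surviving pairs, `6 k²` relevant edges, `12 k² + 2` terminals
  have hsq : R.k * (R.k + 1) + 1 ≤ 3 * R.k ^ 2 := by nlinarith
  have h25 : R.k ^ 2 ≤ R.k ^ 5 := Nat.pow_le_pow_right hk (by norm_num)
  have hone : 1 ≤ R.k ^ 2 := Nat.one_le_pow _ _ hk
  have hq : R.term.length ≤ 14 * R.k ^ 2 := by omega
  have hqq : R.term.length * R.term.length * R.k ≤ 196 * R.k ^ 5 :=
    calc R.term.length * R.term.length * R.k ≤ (14 * R.k ^ 2) * (14 * R.k ^ 2) * R.k :=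
        Nat.mul_le_mul_right _ (Nat.mul_le_mul hq hq)
      _ = 196 * R.k ^ 5 := by ring
  omega

end Raw

end SPFG

namespace RAM

/-! ### Reasoning about programs -/

@[simp] theorem Store.reg_setReg (σ : Store) (x v y : ℕ) :
    (σ.setReg x v).reg y = if y = x then v else σ.reg y := by
  simp [Store.setReg, Function.update_apply]

@[simp] theorem Store.arr_setReg (σ : Store) (x v : ℕ) : (σ.setReg x v).arr = σ.arr := rfl

@[simp] theorem Store.reg_setArr (σ : Store) (a i v : ℕ) : (σ.setArr a i v).reg = σ.reg := rfl

@[simp] theorem Store.arr_setArr (σ : Store) (a i v b : ℕ) :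
    (σ.setArr a i v).arr b = if b = a then Function.update (σ.arr a) i v else σ.arr b := by
  simp [Store.setArr, Function.update_apply]

attribute [simp] Expr.eval

namespace Prog

/-- The registers that a program may change. -/
def wregs : Prog → List ℕ
  | skip => []
  | assign x _ => [x]
  | write _ _ _ => []
  | seq p q => p.wregs ++ q.wregs
  | ite _ p q => p.wregs ++ q.wregs
  | loop _ p => p.wregs

/-- The arrays that a program may change. -/
def warrs : Prog → List ℕ
  | skip => []
  | assign _ _ => []
  | write a _ _ => [a]
  | seq p q => p.warrs ++ q.warrs
  | ite _ p q => p.warrs ++ q.warrs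
  | loop _ p => p.warrs

/-- A bound for the running time in terms of a bound `X` for the number of iterations of each
loop. -/
noncomputable def timePoly : Prog → Polynomial ℕ
  | skip => 1
  | assign _ e => .C (e.cost + 1)
  | write _ i e => .C (i.cost + e.cost + 1)
  | seq p q => p.timePoly + q.timePoly
  | ite e p q => .C (e.cost + 1) + (p.timePoly + q.timePoly)
  | loop e p => (.C (e.cost + 1) + p.timePoly) * .X + .C (e.cost + 1)

/-- Run `p` with `x = 0, 1, …, N - 1`, where `N` is the value of the register `N`. -/
def upto (x N : ℕ) (p : Prog) : Prog :=
  seq (assign x (.const 0))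
    (loop (.sub (.reg N) (.reg x)) (seq p (assign x (.add (.reg x) (.const 1)))))

end Prog

/-- The registers and arrays that `p` does not mention as targets agree in `σ` and `τ`. -/
structure Frame (p : Prog) (σ τ : Store) : Prop where
  reg : ∀ x ∉ p.wregs, τ.reg x = σ.reg x
  arr : ∀ a ∉ p.warrs, τ.arr a = σ.arr a

theorem Frame.refl (p : Prog) (σ : Store) : Frame p σ σ := ⟨fun _ _ => rfl, fun _ _ => rfl⟩

theorem Frame.trans {p : Prog} {σ τ υ : Store} (h : Frame p σ τ) (h' : Frame p τ υ) :
    Frame p σ υ :=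
  ⟨fun x hx => (h'.reg x hx).trans (h.reg x hx), fun a ha => (h'.arr a ha).trans (h.arr a ha)⟩

theorem Frame.mono {p q : Prog} {σ τ : Store} (h : Frame p σ τ) (hr : p.wregs ⊆ q.wregs)
    (ha : p.warrs ⊆ q.warrs) : Frame q σ τ :=
  ⟨fun x hx => h.reg x fun h' => hx (hr h'), fun a hx => h.arr a fun h' => hx (ha h')⟩

theorem Run.frame {p : Prog} {σ τ : Store} {T : ℕ} (h : Run p σ T τ) : Frame p σ τ := by
  induction h with
  | skip => exact .refl _ _
  | assign σ x e =>
    exact ⟨fun y hy => by simp [Prog.wregs] at hy; simp [hy], fun _ _ => rfl⟩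
  | write σ a i e =>
    exact ⟨fun _ _ => rfl, fun b hb => by simp [Prog.warrs] at hb; simp [hb]⟩
  | seq _ _ ih ih' =>
    exact (ih.mono (List.subset_append_left _ _) (List.subset_append_left _ _)).trans
      (ih'.mono (List.subset_append_right _ _) (List.subset_append_right _ _))
  | ite_true _ _ ih => exact ih.mono (List.subset_append_left _ _) (List.subset_append_left _ _)
  | ite_false _ _ ih => exact ih.mono (List.subset_append_right _ _) (List.subset_append_right _ _)
  | loop_exit => exact .refl _ _
  | loop_step _ _ _ ih ih' => exact Frame.trans ⟨ih.reg, ih.arr⟩ ih'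

/-- Started in `σ`, the program `p` halts within the time that is allowed when each loop is iterated
at most `B` times, and then `Q` holds. -/
def Ends (B : ℕ) (p : Prog) (Q : Store → Prop) (σ : Store) : Prop :=
  ∃ T τ, T ≤ p.timePoly.eval B ∧ Run p σ T τ ∧ Q τ

namespace Ends

variable {B : ℕ} {p q : Prog} {Q Q' : Store → Prop} {σ : Store}

/-- The consequence rule, with the knowledge that `p` changes its targets only. -/
theorem mono (h : Ends B p Q σ) (hQ : ∀ τ, Frame p σ τ → Q τ → Q' τ) : Ends B p Q' σ :=
  let ⟨T, τ, hT, hr, h⟩ := h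
  ⟨T, τ, hT, hr, hQ τ hr.frame h⟩

theorem skip (h : Q σ) : Ends B .skip Q σ := ⟨1, σ, by simp [Prog.timePoly], .skip σ, h⟩

theorem assign {x : ℕ} {e : Expr} (h : Q (σ.setReg x (e.eval σ))) : Ends B (.assign x e) Q σ :=
  ⟨_, _, by simp [Prog.timePoly], .assign σ x e, h⟩

theorem write {a : ℕ} {i e : Expr} (h : Q (σ.setArr a (i.eval σ) (e.eval σ))) :
    Ends B (.write a i e) Q σ :=
  ⟨_, _, by simp [Prog.timePoly], .write σ a i e, h⟩

theorem seq (h : Ends B p (Ends B q Q) σ) : Ends B (.seq p q) Q σ := by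
  obtain ⟨T, τ, hT, hr, T', υ, hT', hr', hQ⟩ := h
  exact ⟨T + T', υ, by simp only [Prog.timePoly, Polynomial.eval_add]; omega, .seq hr hr', hQ⟩

theorem ite {e : Expr} (h : e.eval σ ≠ 0 → Ends B p Q σ) (h' : e.eval σ = 0 → Ends B q Q σ) :
    Ends B (.ite e p q) Q σ := by
  by_cases he : e.eval σ = 0
  · obtain ⟨T, τ, hT, hr, hQ⟩ := h' he
    exact ⟨_, τ, by simp only [Prog.timePoly, Polynomial.eval_add, Polynomial.eval_C]; omega,
      .ite_false he hr, hQ⟩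
  · obtain ⟨T, τ, hT, hr, hQ⟩ := h he
    exact ⟨_, τ, by simp only [Prog.timePoly, Polynomial.eval_add, Polynomial.eval_C]; omega,
      .ite_true he hr, hQ⟩

/-- The rule for counting loops, with an invariant that does not depend on the counter. -/
theorem upto {x N n : ℕ} (inv : ℕ → Store → Prop) (hN : σ.reg N = n) (hn : n ≤ B)
    (hinv : ∀ i τ v, inv i τ → inv i (τ.setReg x v)) (h0 : inv 0 σ)
    (hs : ∀ i < n, ∀ τ, Frame (.upto x N p) σ τ → τ.reg x = i → inv i τ → Ends B p (inv (i + 1)) τ)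
    (hQ : ∀ τ, Frame (.upto x N p) σ τ → inv n τ → Q τ)
    (hx : N ≠ x ∧ x ∉ p.wregs ∧ N ∉ p.wregs := by decide) : Ends B (.upto x N p) Q σ := by
  obtain ⟨hxN, hxp, hNp⟩ := hx
  have hw : ∀ y, y ∉ (Prog.upto x N p).wregs → y ≠ x ∧ y ∉ p.wregs := by
    intro y hy
    simp only [Prog.upto, Prog.wregs, List.mem_append, List.mem_singleton, not_or] at hy
    tauto
  have hframe : ∀ τ, Frame (.upto x N p) σ τ → ∀ v, Frame (.upto x N p) σ (τ.setReg x v) := by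
    intro τ h v
    exact ⟨fun y hy => by simp [(hw y hy).1, h.reg y hy], fun a ha => h.arr a ha⟩
  have hframe' : ∀ τ υ, Frame (.upto x N p) σ τ → Frame p τ υ → Frame (.upto x N p) σ υ := by
    intro τ υ h h'
    refine h.trans (h'.mono ?_ ?_) <;> intro y hy <;> simp [Prog.upto, Prog.wregs, Prog.warrs, hy]
  set e : Expr := .sub (.reg N) (.reg x) with he
  set b : Prog := .seq p (.assign x (.add (.reg x) (.const 1))) with hb
  have key : ∀ j i τ, i + j = n → Frame (.upto x N p) σ τ → τ.reg x = i → τ.reg N = n → inv i τ →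
      ∃ T υ, T ≤ (e.cost + 1 + b.timePoly.eval B) * j + (e.cost + 1) ∧ Run (.loop e b) τ T υ ∧
        Frame (.upto x N p) σ υ ∧ inv n υ := by
    intro j
    induction j with
    | zero =>
      intro i τ hij hf hi hNτ h
      refine ⟨_, τ, le_of_eq (by simp), .loop_exit ?_, hf, by rwa [← hij]⟩
      simp [he, hi, hNτ]
      omega
    | succ j ih =>
      intro i τ hij hf hi hNτ h
      obtain ⟨T, υ, hT, hr, hυ⟩ := hs i (by omega) τ hf hi h
      have hυx : υ.reg x = i := (hr.frame.reg x hxp).trans hi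
      have hυN : υ.reg N = n := (hr.frame.reg N hNp).trans hNτ
      have hr' : Run b τ (T + ((Expr.add (.reg x) (.const 1)).cost + 1))
          (υ.setReg x (i + 1)) := by
        have := Run.seq hr (.assign υ x (.add (.reg x) (.const 1)))
        rwa [show (Expr.add (.reg x) (.const 1)).eval υ = i + 1 by simp [hυx]] at this
      obtain ⟨T', ω, hT', hr'', hω⟩ := ih (i + 1) (υ.setReg x (i + 1)) (by omega)
        (hframe _ (hframe' τ υ hf hr.frame) _) (by simp) (by simp [hxN, hυN]) (hinv _ _ _ hυ)
      refine ⟨_, ω, ?_, .loop_step ?_ hr' hr'', hω⟩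
      · rw [Nat.mul_succ]
        simp only [hb, Prog.timePoly, Polynomial.eval_add, Polynomial.eval_C] at hT' ⊢
        omega
      · simp [he, hi, hNτ]
        omega
  obtain ⟨T, υ, hT, hr, hf, hυ⟩ := key n 0 (σ.setReg x 0) (by omega)
    (hframe σ (.refl _ _) 0) (by simp) (by simp [hxN, hN]) (hinv _ _ _ h0)
  refine ⟨_, υ, ?_, .seq (.assign σ x (.const 0)) hr, hQ υ hf hυ⟩
  have := Nat.mul_le_mul_left (e.cost + 1 + b.timePoly.eval B) hn
  change _ ≤ (Prog.seq (.assign x (.const 0)) (.loop e b)).timePoly.eval B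
  simp only [Prog.timePoly, Polynomial.eval_add, Polynomial.eval_mul, Polynomial.eval_C,
    Polynomial.eval_X]
  omega

end Ends

end RAM

namespace SPFG

open RAM

/-! ### Tables and pair lists in memory -/

/-- The array `T` starts with the list `L` of length `q`, and `I` contains, for every element of
`L`, its position plus one, and `0` for every other number. -/
structure Numbered (T I : ℕ → ℕ) (q : ℕ) (L : List ℕ) : Prop where
  len : q = L.length
  get : ∀ i < L.length, T i = L.getD i 0
  idx : ∀ v, I v = if v ∈ L then L.idxOf v + 1 else 0

theorem Numbered.nil {T I : ℕ → ℕ} {q : ℕ} (hI : ∀ v, I v = 0) (hq : q = 0) :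
    Numbered T I q [] := ⟨by simpa, by simp, by simpa⟩

/-- The array `A` contains, from cell `o` on, the list `L` of `c` pairs. -/
structure PairsAt (A : ℕ → ℕ) (o c : ℕ) (L : List (ℕ × ℕ)) : Prop where
  len : c = L.length
  fst : ∀ i < L.length, A (o + 2 * i) = (L.getD i (0, 0)).1
  snd : ∀ i < L.length, A (o + 2 * i + 1) = (L.getD i (0, 0)).2

theorem PairsAt.nil {A : ℕ → ℕ} {o c : ℕ} (hc : c = 0) : PairsAt A o c [] :=
  ⟨by simpa, by simp, by simp⟩

theorem PairsAt.concat {A : ℕ → ℕ} {o c : ℕ} {L : List (ℕ × ℕ)} (h : PairsAt A o c L) (x y : ℕ) :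
    PairsAt (Function.update (Function.update A (o + 2 * c) x) (o + 2 * c + 1) y) o (c + 1)
      (L ++ [(x, y)]) := by
  obtain ⟨rfl, h1, h2⟩ := h
  refine ⟨by simp, fun i hi => ?_, fun i hi => ?_⟩ <;>
  · rw [List.length_append, List.length_singleton] at hi
    rcases Nat.lt_succ_iff_lt_or_eq.1 hi with hi | rfl
    · have e1 : i ≠ L.length := hi.ne
      have e2 : 2 * i ≠ 2 * L.length + 1 := by omega
      have e3 : 2 * i + 1 ≠ 2 * L.length := by omega
      have := h1 i hi
      have := h2 i hi
      simp_all [add_assoc]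
    · simp [add_assoc]

/-! ### Building blocks of the program -/

/-- Sequential composition of programs. -/
infixr:50 " ;; " => Prog.seq

/-- Enter the value of the register `x` into the table `T`, `I`, unless it is there. -/
def addNumber (x T I q : ℕ) : Prog :=
  .ite (.read I (.reg x)) .skip
    (.write T (.reg q) (.reg x) ;;
      .assign q (.add (.reg q) (.const 1)) ;;
      .write I (.reg x) (.reg q))

/-- Append the values of the registers `x`, `y` to a list of pairs that starts in cell `6` of the
array `a` and has `c` elements. -/
def emit (a c x y : ℕ) : Prog :=
  .write a (.add (.const 6) (.add (.reg c) (.reg c))) (.reg x) ;;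
    .write a (.add (.const 7) (.add (.reg c) (.reg c))) (.reg y) ;;
    .assign c (.add (.reg c) (.const 1))

/-- Load the pair number `i` of the list of pairs that starts in cell `o` of the array `a`. -/
def load (a : ℕ) (o : Expr) (i x y : ℕ) : Prog :=
  .assign x (.read a (.add o (.add (.reg i) (.reg i)))) ;;
    .assign y (.read a (.add (.add o (.add (.reg i) (.reg i))) (.const 1)))

theorem addNumber_spec {B x T I q : ℕ} {σ : Store} {L : List ℕ}
    (h : Numbered (σ.arr T) (σ.arr I) (σ.reg q) L) (hd : x ≠ q ∧ T ≠ I := by decide) :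
    Ends B (addNumber x T I q)
      (fun τ => Numbered (τ.arr T) (τ.arr I) (τ.reg q) (addNew L (σ.reg x))) σ := by
  obtain ⟨hxq, hTI⟩ := hd
  obtain ⟨hlen, hget, hidx⟩ := h
  refine Ends.ite (fun he => .skip ?_) fun he => .seq <| .write <| .seq <| .assign <| .write ?_
  · have hm : σ.reg x ∈ L := by
      by_contra hn
      simp [hidx, hn] at he
    rw [addNew, if_pos hm]
    exact ⟨hlen, hget, hidx⟩
  · have hm : σ.reg x ∉ L := by
      intro hm
      simp [hidx, hm] at he
    rw [addNew, if_neg hm]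
    constructor
    · simp [hlen]
    · intro i hi
      rw [List.length_append, List.length_singleton] at hi
      rcases Nat.lt_succ_iff_lt_or_eq.1 hi with hi | rfl
      · have e1 : i ≠ L.length := hi.ne
        have := hget i hi
        simp_all
      · simp [hTI, hlen]
    · intro v
      by_cases hv : v = σ.reg x
      · subst hv
        simp [hxq, hlen, List.idxOf_append_of_notMem hm]
      · by_cases hvL : v ∈ L
        · simp [hv, hTI.symm, hidx, hxq, hvL, List.idxOf_append_of_mem hvL]
        · simp [hv, hTI.symm, hidx, hxq, hvL]

theorem emit_spec {B a c x y : ℕ} {σ : Store} {L : List (ℕ × ℕ)}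
    (h : PairsAt (σ.arr a) 6 (σ.reg c) L) :
    Ends B (emit a c x y)
      (fun τ => PairsAt (τ.arr a) 6 (τ.reg c) (L ++ [(σ.reg x, σ.reg y)])) σ := by
  refine .seq <| .write <| .seq <| .write <| .assign ?_
  have := h.concat (σ.reg x) (σ.reg y)
  simpa [← two_mul, show 6 + 2 * σ.reg c + 1 = 7 + 2 * σ.reg c by omega] using this

theorem load_spec {B a i x y c k : ℕ} {o : Expr} {σ : Store} {L : List (ℕ × ℕ)}
    (h : PairsAt (σ.arr a) (o.eval σ) c L) (hi : σ.reg i = k) (hk : k < L.length)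
    (ho : ∀ v, o.eval (σ.setReg x v) = o.eval σ) (hd : i ≠ x ∧ x ≠ y := by decide) :
    Ends B (load a o i x y)
      (fun τ => τ.reg x = (L.getD k (0, 0)).1 ∧ τ.reg y = (L.getD k (0, 0)).2) σ := by
  refine .seq <| .assign <| .assign ?_
  have h1 := h.fst k hk
  have h2 := h.snd k hk
  simp only [List.getD_eq_getElem?_getD] at h1 h2
  simp [ho, hi, hd.1, hd.2, ← two_mul, h1, h2]

/-! ### The memory layout -/

namespace Reg

abbrev n : ℕ := 0
abbrev m : ℕ := 1
abbrev p : ℕ := 2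
abbrev s : ℕ := 3
abbrev t : ℕ := 4
abbrev k : ℕ := 5
/-- the number of relevant edges -/
abbrev rel : ℕ := 6
/-- the number of terminals -/
abbrev term : ℕ := 7
/-- the number of surviving forcing edges -/
abbrev kept : ℕ := 8
/-- the maximal number of surviving forcing edges -/
abbrev lim : ℕ := 9
/-- the number of pairs in the output -/
abbrev out : ℕ := 10
/-- the start of the current block of fresh vertices -/
abbrev base : ℕ := 11
/-- the cell of the input where the list of forcing edges starts -/
abbrev f : ℕ := 12
/-- the number of edges in the output -/
abbrev edges : ℕ := 13
abbrev i : ℕ := 14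
abbrev j : ℕ := 15
abbrev u : ℕ := 16
abbrev v : ℕ := 17
abbrev round : ℕ := 18
abbrev a : ℕ := 19
abbrev b : ℕ := 20
abbrev d : ℕ := 21
abbrev x : ℕ := 22
abbrev y : ℕ := 23

end Reg

namespace Arr

abbrev input : ℕ := 0
abbrev output : ℕ := 1
/-- the degrees with respect to the surviving forcing edges -/
abbrev deg : ℕ := 2
/-- the relevant edges -/
abbrev rel : ℕ := 3
abbrev relIdx : ℕ := 4
/-- the terminals -/
abbrev term : ℕ := 5
abbrev termIdx : ℕ := 6
/-- the surviving forcing edges -/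
abbrev kept : ℕ := 7
/-- distances from the current terminal -/
abbrev dist : ℕ := 8

end Arr

/-- The instance `R` has been read. -/
structure Ready (R : Raw) (σ : Store) : Prop where
  n : σ.reg Reg.n = R.n
  m : σ.reg Reg.m = R.E.length
  p : σ.reg Reg.p = R.F.length
  s : σ.reg Reg.s = R.s
  t : σ.reg Reg.t = R.t
  k : σ.reg Reg.k = R.k
  f : σ.reg Reg.f = 6 + 2 * R.E.length
  E : PairsAt (σ.arr Arr.input) 6 R.E.length R.E
  F : PairsAt (σ.arr Arr.input) (6 + 2 * R.E.length) R.F.length R.F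

theorem Ready.frame {R : Raw} {p : Prog} {σ τ : Store} (h : Ready R σ) (hf : Frame p σ τ)
    (hd : (∀ x ∈ [Reg.n, Reg.m, Reg.p, Reg.s, Reg.t, Reg.k, Reg.f], x ∉ p.wregs) ∧
      Arr.input ∉ p.warrs := by decide) : Ready R τ := by
  obtain ⟨hr, ha⟩ := hd
  have ha' := hf.arr _ ha
  constructor
  · rw [hf.reg _ (hr _ (by simp)), h.n]
  · rw [hf.reg _ (hr _ (by simp)), h.m]
  · rw [hf.reg _ (hr _ (by simp)), h.p]
  · rw [hf.reg _ (hr _ (by simp)), h.s]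
  · rw [hf.reg _ (hr _ (by simp)), h.t]
  · rw [hf.reg _ (hr _ (by simp)), h.k]
  · rw [hf.reg _ (hr _ (by simp)), h.f]
  · rw [ha']; exact h.E
  · rw [ha']; exact h.F

/-! ### Reading the instance -/

/-- Read the header, lower the budget to the number of edges plus one, and compute the maximal
number of surviving forcing edges. -/
def readInstance : Prog :=
  .assign Reg.n (.read Arr.input (.const 0)) ;;
  .assign Reg.m (.read Arr.input (.const 1)) ;;
  .assign Reg.p (.read Arr.input (.const 2)) ;;
  .assign Reg.s (.read Arr.input (.const 3)) ;;
  .assign Reg.t (.read Arr.input (.const 4)) ;;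
  .assign Reg.k (.read Arr.input (.const 5)) ;;
  .assign Reg.f (.add (.const 6) (.add (.reg Reg.m) (.reg Reg.m))) ;;
  .assign Reg.lim (.const 1) ;;
  .ite (.sub (.reg Reg.k) (.add (.reg Reg.m) (.const 1)))
    (.assign Reg.k (.add (.reg Reg.m) (.const 1))) .skip ;;
  .upto Reg.i Reg.k
    (.assign Reg.lim (.add (.reg Reg.lim) (.add (.reg Reg.k) (.const 1))))

/-- The instance with the lowered budget. -/
def Raw.capped (R : Raw) : Raw := { R with k := min R.k (R.E.length + 1) }

theorem input_pairsAt (R : Raw) :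
    PairsAt ((Store.init R.word).arr Arr.input) 6 R.E.length R.E ∧
      PairsAt ((Store.init R.word).arr Arr.input) (6 + 2 * R.E.length) R.F.length R.F := by
  have hE : ∀ i, i < 2 * R.E.length → (Store.init R.word).arr 0 (6 + i) = (flat R.E).getD i 0 := by
    intro i hi
    simp only [Store.init, if_true, Raw.word, List.append_assoc]
    rw [List.getD_append_right _ _ _ _ (by simp)]
    rw [List.getD_append _ _ _ _ (by rw [length_flat]; simpa using hi)]
    simp
  have hF : ∀ i, (Store.init R.word).arr 0 (6 + 2 * R.E.length + i) = (flat R.F).getD i 0 := by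
    intro i
    simp only [Store.init, if_true, Raw.word]
    rw [List.getD_append_right _ _ _ _ (by simp [length_flat]; omega)]
    congr 1
    simp [length_flat]
    omega
  refine ⟨⟨rfl, fun i hi => ?_, fun i hi => ?_⟩, ⟨rfl, fun i hi => ?_, fun i hi => ?_⟩⟩
  · rw [hE _ (by omega), (getD_flat _ _).1]
  · rw [add_assoc, hE _ (by omega), (getD_flat _ _).2]
  · rw [hF, (getD_flat _ _).1]
  · rw [add_assoc (6 + _), hF, (getD_flat _ _).2]

theorem readInstance_spec {B : ℕ} (R : Raw) (hB : R.E.length + 1 ≤ B) :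
    Ends B readInstance (fun τ => Ready R.capped τ ∧
      τ.reg Reg.lim = R.capped.k * (R.capped.k + 1) + 1) (Store.init R.word) := by
  obtain ⟨hE, hF⟩ := input_pairsAt R
  have h0 : (Store.init R.word).arr Arr.input 0 = R.n := rfl
  have h1 : (Store.init R.word).arr Arr.input 1 = R.E.length := rfl
  have h2 : (Store.init R.word).arr Arr.input 2 = R.F.length := rfl
  have h3 : (Store.init R.word).arr Arr.input 3 = R.s := rfl
  have h4 : (Store.init R.word).arr Arr.input 4 = R.t := rfl
  have h5 : (Store.init R.word).arr Arr.input 5 = R.k := rfl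
  generalize Store.init R.word = σ at *
  refine .seq <| .assign <| .seq <| .assign <| .seq <| .assign <| .seq <| .assign <|
    .seq <| .assign <| .seq <| .assign <| .seq <| .assign <| .seq <| .assign ?_
  refine .seq <| .mono (Q := fun τ => Ready R.capped τ ∧ τ.reg Reg.lim = 1) ?_ ?_
  · refine .ite (fun he => .assign ⟨?_, ?_⟩) fun he => .skip ⟨?_, ?_⟩
    · simp [h1, h5] at he
      have hk : R.capped.k = R.E.length + 1 := by simp only [Raw.capped]; omega
      constructor <;> simp [h0, h1, h2, h3, h4, h5, hk, ← two_mul] <;> simp [Raw.capped, hE, hF]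
    · simp
    · simp [h1, h5] at he
      have hk : R.capped.k = R.k := by simp only [Raw.capped]; omega
      constructor <;> simp [h0, h1, h2, h3, h4, h5, hk, ← two_mul] <;> simp [Raw.capped, hE, hF]
    · simp
  · rintro τ - ⟨hr, hl⟩
    have hkB : R.capped.k ≤ B := le_trans (min_le_right _ _) hB
    refine .upto (fun i υ => υ.reg Reg.lim = 1 + i * (R.capped.k + 1)) hr.k hkB
      (fun i υ v h => by simpa using h) (by simpa using hl) (fun i _ υ hf _ h => ?_)
      fun υ hf h => ⟨hr.frame hf, by rw [h, add_comm]⟩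
    refine .assign ?_
    have hk : υ.reg Reg.k = R.capped.k := (hr.frame hf).k
    simp [h, hk]
    ring

end SPFG

namespace SPFG

open RAM

/-! ### Selecting forcing edges and terminals -/

/-- Increment the degrees of the ends of the current forcing edge. -/
def countPair : Prog :=
  .write Arr.deg (.reg Reg.a) (.add (.read Arr.deg (.reg Reg.a)) (.const 1)) ;;
  .write Arr.deg (.reg Reg.b) (.add (.read Arr.deg (.reg Reg.b)) (.const 1))

/-- Keep the current forcing edge. -/
def keepPair : Prog :=
  countPair ;;
  emit Arr.kept Reg.kept Reg.a Reg.b ;;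
  addNumber Reg.a Arr.rel Arr.relIdx Reg.rel ;;
  addNumber Reg.b Arr.rel Arr.relIdx Reg.rel

/-- Pass through the forcing edges, keep those that `keepStep` keeps, and number their ends. -/
def selectPairs : Prog :=
  .upto Reg.j Reg.p
    (load Arr.input (.reg Reg.f) Reg.j Reg.a Reg.b ;;
      .ite (.sub (.add (.reg Reg.k) (.const 1)) (.read Arr.deg (.reg Reg.a)))
        (.ite (.sub (.add (.reg Reg.k) (.const 1)) (.read Arr.deg (.reg Reg.b)))
          (.ite (.sub (.reg Reg.lim) (.reg Reg.kept)) keepPair .skip) .skip) .skip)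

/-- The memory during `selectPairs`, when `K` is the list of the pairs kept so far. -/
structure Selected (K : List (ℕ × ℕ)) (σ : Store) : Prop where
  deg : ∀ a, σ.arr Arr.deg a = SPFG.deg K a
  pairs : PairsAt (σ.arr Arr.kept) 6 (σ.reg Reg.kept) K
  rel : Numbered (σ.arr Arr.rel) (σ.arr Arr.relIdx) (σ.reg Reg.rel) (number (flat K))

/-- The two increments do not interfere, since a forcing edge has two different ends. -/
theorem countPair_spec {B : ℕ} {σ : Store} {K : List (ℕ × ℕ)} {f : ℕ × ℕ}
    (h : ∀ a, σ.arr Arr.deg a = deg K a) (ha : σ.reg Reg.a = f.1) (hb : σ.reg Reg.b = f.2)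
    (hf : f.1 ≠ f.2) :
    Ends B countPair (fun τ => ∀ a, τ.arr Arr.deg a = deg (K ++ [f]) a) σ := by
  refine .seq <| .write <| .write fun c => ?_
  rw [deg_concat]
  by_cases h1 : c = f.1
  · subst h1
    simp [h, ha, hb, hf]
  · by_cases h2 : c = f.2
    · subst h2
      simp [h, ha, hb, hf.symm]
    · simp [h, ha, hb, h1, h2, Ne.symm h1, Ne.symm h2]

theorem keepPair_spec {B : ℕ} {σ : Store} {K : List (ℕ × ℕ)} {f : ℕ × ℕ} (h : Selected K σ)
    (ha : σ.reg Reg.a = f.1) (hb : σ.reg Reg.b = f.2) (hf : f.1 ≠ f.2) :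
    Ends B keepPair (Selected (K ++ [f])) σ := by
  refine .seq <| (countPair_spec h.deg ha hb hf).mono fun τ₁ hf₁ h₁ => ?_
  have hk : PairsAt (τ₁.arr Arr.kept) 6 (τ₁.reg Reg.kept) K := by
    rw [hf₁.arr _ (by decide), hf₁.reg _ (by decide)]
    exact h.pairs
  refine .seq <| (emit_spec hk).mono fun τ₂ hf₂ h₂ => ?_
  have hr : Numbered (τ₂.arr Arr.rel) (τ₂.arr Arr.relIdx) (τ₂.reg Reg.rel) (number (flat K)) := by
    rw [hf₂.arr _ (by decide), hf₂.arr _ (by decide), hf₂.reg _ (by decide),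
      hf₁.arr _ (by decide), hf₁.arr _ (by decide), hf₁.reg _ (by decide)]
    exact h.rel
  refine .seq <| (addNumber_spec hr).mono fun τ₃ hf₃ h₃ => ?_
  refine (addNumber_spec h₃).mono fun τ₄ hf₄ h₄ => ⟨?_, ?_, ?_⟩
  · rw [hf₄.arr _ (by decide), hf₃.arr _ (by decide), hf₂.arr _ (by decide)]
    exact h₁
  · rw [hf₄.arr _ (by decide), hf₃.arr _ (by decide), hf₄.reg _ (by decide),
      hf₃.reg _ (by decide)]
    rwa [hf₁.reg _ (by decide), hf₁.reg _ (by decide), ha, hb] at h₂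
  · rw [hf₃.reg _ (by decide), hf₂.reg _ (by decide), hf₂.reg _ (by decide),
      hf₁.reg _ (by decide), hf₁.reg _ (by decide), ha, hb] at h₄
    have : number (flat (K ++ [f])) = addNew (addNew (number (flat K)) f.1) f.2 := by
      rw [flat_append, show flat [f] = [f.1] ++ [f.2] from rfl, ← List.append_assoc,
        number_concat, number_concat]
    rwa [this]

theorem selectPairs_spec {B : ℕ} {R : Raw} {σ : Store} (hR : Ready R σ) (hv : R.Valid)
    (hB : R.F.length ≤ B) (hlim : σ.reg Reg.lim = R.k * (R.k + 1) + 1) (h0 : Selected [] σ) :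
    Ends B selectPairs (Selected R.keptPairs) σ := by
  refine .upto (fun j => Selected (kept R.k (R.F.take j))) hR.p hB (fun j τ v h => ?_) ?_
    (fun j hj τ hf hjτ h => ?_) (fun τ hf h => ?_)
  · exact ⟨h.deg, h.pairs, h.rel⟩
  · simpa [kept] using h0
  · have hR' : Ready R τ := hR.frame hf
    have hF := hR'.F
    have hfe : (Expr.reg Reg.f).eval τ = 6 + 2 * R.E.length := hR'.f
    rw [← hfe] at hF
    refine .seq <| (load_spec hF hjτ hj fun v => by simp).mono fun υ hfυ ⟨ha, hb⟩ => ?_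
    have hsel : Selected (kept R.k (R.F.take j)) υ := by
      refine ⟨?_, ?_, ?_⟩
      · rw [hfυ.arr _ (by decide)]
        exact h.deg
      · rw [hfυ.arr _ (by decide), hfυ.reg _ (by decide)]
        exact h.pairs
      · rw [hfυ.arr _ (by decide), hfυ.arr _ (by decide), hfυ.reg _ (by decide)]
        exact h.rel
    have hk : υ.reg Reg.k = R.k := by rw [hfυ.reg _ (by decide), hR'.k]
    have hl : υ.reg Reg.lim = R.k * (R.k + 1) + 1 := by
      rw [hfυ.reg _ (by decide), hf.reg _ (by decide), hlim]
    rw [List.getD_eq_getElem _ _ hj] at ha hb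
    have hstep : kept R.k (R.F.take (j + 1)) = keepStep R.k (kept R.k (R.F.take j)) R.F[j] := by
      rw [List.take_succ_eq_append_getElem hj, kept_concat]
    rw [hstep, keepStep]
    have hlen := hsel.pairs.len
    have hda := hsel.deg R.F[j].1
    have hdb := hsel.deg R.F[j].2
    refine .ite (fun h1 => .ite (fun h2 => .ite (fun h3 => ?_) fun h3 => .skip ?_)
      fun h2 => .skip ?_) fun h1 => .skip ?_
    · simp only [Expr.eval, hk, hl, ha, hb, hda, hdb, hlen] at h1 h2 h3
      rw [if_pos (by omega)]
      exact keepPair_spec hsel ha hb (hv.F.ne _ (List.getElem_mem hj))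
    · simp only [Expr.eval, hl, hlen] at h3
      rw [if_neg (by omega)]
      exact hsel
    · simp only [Expr.eval, hk, hb, hdb] at h2
      rw [if_neg (by omega)]
      exact hsel
    · simp only [Expr.eval, hk, ha, hda] at h1
      rw [if_neg (by omega)]
      exact hsel
  · rwa [List.take_length] at h

/-- Number the terminals: `s`, `t`, and the ends of the relevant edges. -/
def numberTerms : Prog :=
  addNumber Reg.s Arr.term Arr.termIdx Reg.term ;;
  addNumber Reg.t Arr.term Arr.termIdx Reg.term ;;
  .upto Reg.i Reg.rel
    (.assign Reg.j (.read Arr.rel (.reg Reg.i)) ;;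
      load Arr.input (.const 6) Reg.j Reg.a Reg.b ;;
      addNumber Reg.a Arr.term Arr.termIdx Reg.term ;;
      addNumber Reg.b Arr.term Arr.termIdx Reg.term)

/-- Write the relevant edges to the output. -/
def emitRel : Prog :=
  .upto Reg.i Reg.rel
    (.assign Reg.j (.read Arr.rel (.reg Reg.i)) ;;
      load Arr.input (.const 6) Reg.j Reg.a Reg.b ;;
      .assign Reg.x (.sub (.read Arr.termIdx (.reg Reg.a)) (.const 1)) ;;
      .assign Reg.y (.sub (.read Arr.termIdx (.reg Reg.b)) (.const 1)) ;;
      emit Arr.output Reg.out Reg.x Reg.y)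

/-- The relevant edges are numbered. -/
def RelNumbered (R : Raw) (σ : Store) : Prop :=
  Numbered (σ.arr Arr.rel) (σ.arr Arr.relIdx) (σ.reg Reg.rel) R.rel

/-- The terminals in the list `L` are numbered. -/
def TermNumbered (L : List ℕ) (σ : Store) : Prop :=
  Numbered (σ.arr Arr.term) (σ.arr Arr.termIdx) (σ.reg Reg.term) L

theorem RelNumbered.frame {R : Raw} {p : Prog} {σ τ : Store} (h : RelNumbered R σ)
    (hf : Frame p σ τ) (hd : Arr.rel ∉ p.warrs ∧ Arr.relIdx ∉ p.warrs ∧ Reg.rel ∉ p.wregs := by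
      decide) : RelNumbered R τ := by
  rw [RelNumbered, hf.arr _ hd.1, hf.arr _ hd.2.1, hf.reg _ hd.2.2]
  exact h

theorem TermNumbered.frame {L : List ℕ} {p : Prog} {σ τ : Store} (h : TermNumbered L σ)
    (hf : Frame p σ τ) (hd : Arr.term ∉ p.warrs ∧ Arr.termIdx ∉ p.warrs ∧ Reg.term ∉ p.wregs := by
      decide) : TermNumbered L τ := by
  rw [TermNumbered, hf.arr _ hd.1, hf.arr _ hd.2.1, hf.reg _ hd.2.2]
  exact h

/-- Load the ends of the relevant edge number `i`. -/
theorem loadRel_spec {B i : ℕ} {R : Raw} {σ : Store} (hR : Ready R σ) (hv : R.Valid)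
    (hrel : RelNumbered R σ) (hi : i < R.rel.length) (hσ : σ.reg Reg.i = i) {p : Prog}
    {Q : Store → Prop}
    (h : ∀ τ, Frame (.assign Reg.j (.read Arr.rel (.reg Reg.i)) ;;
        load Arr.input (.const 6) Reg.j Reg.a Reg.b) σ τ →
      τ.reg Reg.a = (R.E.getD R.rel[i] (0, 0)).1 → τ.reg Reg.b = (R.E.getD R.rel[i] (0, 0)).2 →
      Ends B p Q τ) :
    Ends B (.assign Reg.j (.read Arr.rel (.reg Reg.i)) ;;
      load Arr.input (.const 6) Reg.j Reg.a Reg.b ;; p) Q σ := by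
  have hget : σ.arr Arr.rel i = R.rel[i] := by
    rw [hrel.get i hi, List.getD_eq_getElem _ _ hi]
  have hlt := hv.rel_lt (List.getElem_mem hi)
  have hload : Ends B (.assign Reg.j (.read Arr.rel (.reg Reg.i)) ;;
      load Arr.input (.const 6) Reg.j Reg.a Reg.b)
      (fun τ => τ.reg Reg.a = (R.E.getD R.rel[i] (0, 0)).1 ∧
        τ.reg Reg.b = (R.E.getD R.rel[i] (0, 0)).2) σ :=
    .seq <| .assign <| load_spec (c := R.E.length) (k := R.rel[i]) hR.E
      (by simp [hσ, hget]) hlt fun v => rfl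
  obtain ⟨T, τ, hT, hr, hQ⟩ := hload
  obtain ⟨T', υ, hT', hr', hQ'⟩ := h τ hr.frame hQ.1 hQ.2
  cases hr with
  | seq hr₁ hr₂ =>
    refine ⟨_, υ, ?_, .seq hr₁ (.seq hr₂ hr'), hQ'⟩
    simp only [Prog.timePoly, Polynomial.eval_add] at hT ⊢
    omega

theorem numberTerms_spec {B : ℕ} {R : Raw} {σ : Store} (hR : Ready R σ) (hv : R.Valid)
    (hB : R.rel.length ≤ B) (hrel : RelNumbered R σ) (h0 : TermNumbered [] σ) :
    Ends B numberTerms (TermNumbered R.term) σ := by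
  refine .seq <| (addNumber_spec h0).mono fun τ₁ hf₁ h₁ => ?_
  refine .seq <| (addNumber_spec h₁).mono fun τ₂ hf₂ h₂ => ?_
  have hR₁ := hR.frame hf₁
  have hR₂ := hR₁.frame hf₂
  have hrel₂ := (hrel.frame hf₁).frame hf₂
  rw [hR.s, hR₁.t] at h₂
  refine .upto (fun i => TermNumbered (number (R.s :: R.t ::
      flat ((R.rel.take i).map fun i => R.E.getD i (0, 0))))) hrel₂.len hB
    (fun _ _ _ h => h) (by simpa [TermNumbered, flat, number] using h₂) (fun i hi τ hf hiτ h => ?_)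
    (fun τ hf h => ?_)
  · refine loadRel_spec (hR₂.frame hf) hv (hrel₂.frame hf) hi hiτ fun υ hfυ ha hb => ?_
    refine .seq <| (addNumber_spec (h.frame hfυ)).mono fun υ' hfυ' h' => ?_
    refine (addNumber_spec h').mono fun ω hω h'' => ?_
    rw [hfυ'.reg _ (by decide), ha, hb] at h''
    rw [List.take_succ_eq_append_getElem hi, List.map_append, flat_append]
    have : flat ([R.rel[i]].map fun i => R.E.getD i (0, 0)) =
        [(R.E.getD R.rel[i] (0, 0)).1] ++ [(R.E.getD R.rel[i] (0, 0)).2] := rfl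
    rw [this, ← List.cons_append, ← List.cons_append, ← List.append_assoc, number_concat,
      number_concat]
    exact h''
  · rwa [List.take_length] at h

theorem emitRel_spec {B : ℕ} {R : Raw} {σ : Store} (hR : Ready R σ) (hv : R.Valid)
    (hB : R.rel.length ≤ B) (hrel : RelNumbered R σ) (hterm : TermNumbered R.term σ)
    (h0 : σ.reg Reg.out = 0) :
    Ends B emitRel (fun τ => PairsAt (τ.arr Arr.output) 6 (τ.reg Reg.out) R.relPairs) σ := by
  refine .upto (fun i τ => PairsAt (τ.arr Arr.output) 6 (τ.reg Reg.out) (R.relPairs.take i))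
    hrel.len hB (fun _ _ _ h => h) (by simpa using PairsAt.nil h0) (fun i hi τ hf hiτ h => ?_)
    (fun τ hf h => ?_)
  · have hterm' := hterm.frame hf
    refine loadRel_spec (hR.frame hf) hv (hrel.frame hf) hi hiτ fun υ hfυ ha hb => ?_
    have hmem := R.mem_term_of_mem_rel (List.getElem_mem hi)
    have hidx := (hterm'.frame hfυ).idx
    have hx := hidx (R.E.getD R.rel[i] (0, 0)).1
    have hy := hidx (R.E.getD R.rel[i] (0, 0)).2
    rw [if_pos hmem.1] at hx
    rw [if_pos hmem.2] at hy
    refine .seq <| .assign <| .seq <| .assign <| (emit_spec (L := R.relPairs.take i) ?_).mono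
      fun ω hω h' => ?_
    · simpa [hfυ.arr Arr.output (by decide), hfυ.reg Reg.out (by decide)] using h
    · have hi' : i < R.relPairs.length := by rwa [Raw.length_relPairs]
      rw [List.take_succ_eq_append_getElem hi']
      simp only [List.getD_eq_getElem?_getD] at ha hb hx hy
      simpa [Raw.relPairs, ha, hb, hx, hy] using h'
  · rwa [← Raw.length_relPairs, List.take_length] at h

end SPFG

namespace SPFG

open RAM

/-! ### Computing bounded distances -/

/-- Improve the distance of `y` by a step from `x`. -/
def relaxed (D : ℕ → ℕ) (x y : ℕ) : ℕ → ℕ := Function.update D y (min (D y) (D x + 1))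

/-- What is known about the tentative distances `D` from `src` in round `r`, when the first `i`
edges have been looked at in this round. -/
structure DistInv (R : Raw) (src r i : ℕ) (D : ℕ → ℕ) : Prop where
  le : ∀ w < R.n, D w ≤ R.k + 1
  sound : ∀ w < R.n, D w ≤ R.k → Hops R.Free (D w) src w
  complete : ∀ ℓ ≤ r, ∀ w, Hops R.Free ℓ src w → D w ≤ ℓ
  step : ∀ i' < i, i' ∉ R.rel → ∀ x y, Joins R.E i' x y → Hops R.Free r src x → D y ≤ r + 1

theorem relaxed_le (D : ℕ → ℕ) (x y w : ℕ) : relaxed D x y w ≤ D w := by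
  rw [relaxed, Function.update_apply]
  split_ifs with h
  · exact h ▸ min_le_left _ _
  · exact le_rfl

theorem relaxed_self_le (D : ℕ → ℕ) (x y : ℕ) : relaxed D x y y ≤ D x + 1 := by
  simp [relaxed]

theorem DistInv.relaxed {R : Raw} {src r i : ℕ} {D : ℕ → ℕ} (h : DistInv R src r i D) {x y : ℕ}
    (hx : x < R.n) (hxy : R.Free x y) : DistInv R src r i (relaxed D x y) := by
  refine ⟨fun w hw => (relaxed_le _ _ _ _).trans (h.le w hw), fun w hw hk => ?_,
    fun ℓ hℓ w hh => (relaxed_le _ _ _ _).trans (h.complete ℓ hℓ w hh),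
    fun i' hi hr a b hj hh => (relaxed_le _ _ _ _).trans (h.step i' hi hr a b hj hh)⟩
  by_cases hwy : w = y
  · subst hwy
    rw [SPFG.relaxed, Function.update_self] at hk ⊢
    rcases min_choice (D w) (D x + 1) with e | e <;> rw [e] at hk ⊢
    · exact h.sound w hw hk
    · exact (h.sound x hx (by omega)).succ hxy
  · rw [SPFG.relaxed, Function.update_of_ne hwy] at hk ⊢
    exact h.sound w hw hk

theorem DistInv.skip {R : Raw} {src r i : ℕ} {D : ℕ → ℕ} (h : DistInv R src r i D)
    (hi : i ∈ R.rel) : DistInv R src r (i + 1) D := by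
  refine ⟨h.le, h.sound, h.complete, fun i' hi' hr => ?_⟩
  rcases Nat.lt_succ_iff_lt_or_eq.1 hi' with h' | rfl
  · exact h.step i' h' hr
  · exact absurd hi hr

theorem DistInv.relaxed_both {R : Raw} {src r i : ℕ} {D : ℕ → ℕ} (h : DistInv R src r i D)
    {x y : ℕ} (hE : R.E[i]? = some (x, y)) (hi : i ∉ R.rel) (hx : x < R.n) (hy : y < R.n) :
    DistInv R src r (i + 1) (SPFG.relaxed (SPFG.relaxed D x y) y x) := by
  have hfree : R.Free x y := ⟨i, by simpa using hi, .inl hE⟩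
  have h' := (h.relaxed hx hfree).relaxed hy hfree.symm
  refine ⟨h'.le, h'.sound, h'.complete, fun i' hi' hr a b hj hh => ?_⟩
  rcases Nat.lt_succ_iff_lt_or_eq.1 hi' with hlt | rfl
  · exact h'.step i' hlt hr a b hj hh
  · have hD := h.complete r le_rfl a hh
    simp only [Joins, hE, Option.some.injEq, Prod.mk.injEq] at hj
    rcases hj with ⟨rfl, rfl⟩ | ⟨rfl, rfl⟩
    · have h1 := relaxed_le (SPFG.relaxed D x y) y x y
      have h2 := relaxed_self_le D x y
      omega
    · have h1 := relaxed_self_le (SPFG.relaxed D x y) y x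
      have h2 := relaxed_le D x y y
      omega

theorem DistInv.next {R : Raw} {src r : ℕ} {D : ℕ → ℕ}
    (h : DistInv R src r R.E.length D) : DistInv R src (r + 1) 0 D := by
  refine ⟨h.le, h.sound, fun ℓ hℓ w hh => ?_, fun _ h => by omega⟩
  rcases Nat.lt_succ_iff_lt_or_eq.1 (Nat.lt_succ_of_le hℓ) with hlt | rfl
  · exact h.complete ℓ (by omega) w hh
  · obtain ⟨x, hx, i, hi, hj⟩ := hops_succ.1 hh
    refine h.step i ?_ (by simpa using hi) x w hj hx
    by_contra hlt
    rcases hj with h | h <;> simp [List.getElem?_eq_none (not_lt.1 hlt)] at h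

theorem DistInv.eq {R : Raw} {src : ℕ} {D : ℕ → ℕ} (h : DistInv R src R.k 0 D) {w : ℕ}
    (hw : w < R.n) : D w = cappedDist R.Free R.k src w := by
  apply le_antisymm
  · by_cases hk : cappedDist R.Free R.k src w ≤ R.k
    · exact h.complete _ hk w (Hops.of_cappedDist hk)
    · have := h.le w hw
      omega
  · by_cases hk : D w ≤ R.k
    · exact cappedDist_le hk (h.sound w hw hk)
    · have := cappedDist_le_succ R.Free R.k src w
      omega

/-- Set the distance of the terminal number `u` to zero and all other distances to `k + 1`. -/
def initDist : Prog :=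
  .upto Reg.i Reg.n (.write Arr.dist (.reg Reg.i) (.add (.reg Reg.k) (.const 1))) ;;
  .write Arr.dist (.read Arr.term (.reg Reg.u)) (.const 0)

/-- Improve the distance of `y` by a step from `x`. -/
def relax (x y : ℕ) : Prog :=
  .ite (.sub (.read Arr.dist (.reg y)) (.add (.read Arr.dist (.reg x)) (.const 1)))
    (.write Arr.dist (.reg y) (.add (.read Arr.dist (.reg x)) (.const 1))) .skip

/-- The distances from the terminal number `u`, by the algorithm of Bellman and Ford. -/
def distances : Prog :=
  initDist ;;
  .upto Reg.round Reg.k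
    (.upto Reg.i Reg.m
      (.ite (.read Arr.relIdx (.reg Reg.i)) .skip
        (load Arr.input (.const 6) Reg.i Reg.a Reg.b ;;
          relax Reg.a Reg.b ;; relax Reg.b Reg.a)))

theorem relax_spec {B x y : ℕ} {σ : Store} :
    Ends B (relax x y)
      (fun τ => τ.arr Arr.dist = relaxed (σ.arr Arr.dist) (σ.reg x) (σ.reg y)) σ := by
  refine .ite (fun h => .write ?_) fun h => .skip ?_
  · simp only [Expr.eval] at h
    simp [relaxed, min_eq_right (show σ.arr Arr.dist (σ.reg x) + 1 ≤ σ.arr Arr.dist (σ.reg y) by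
      omega)]
  · simp only [Expr.eval] at h
    rw [relaxed, min_eq_left (by omega), Function.update_eq_self]

theorem initDist_spec {B src : ℕ} {R : Raw} {σ : Store} (hR : Ready R σ) (hB : R.n ≤ B)
    (hsrc : σ.arr Arr.term (σ.reg Reg.u) = src) :
    Ends B initDist (fun τ => DistInv R src 0 0 (τ.arr Arr.dist)) σ := by
  refine .seq <| .upto (fun i τ => ∀ w < i, τ.arr Arr.dist w = R.k + 1) hR.n hB
    (fun _ _ _ h => h) (fun w hw => by omega) (fun i hi τ hf hiτ h => .write fun w hw => ?_)
    (fun τ hf h => .write ?_)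
  · have hk := (hR.frame hf).k
    rcases Nat.lt_succ_iff_lt_or_eq.1 hw with hw | rfl
    · have : w ≠ i := hw.ne
      simp [hiτ, this, h w hw]
    · simp [hiτ, hk]
  · have hu : τ.arr Arr.term (τ.reg Reg.u) = src := by
      rw [hf.arr _ (by decide), hf.reg _ (by decide), hsrc]
    have hD : (τ.setArr Arr.dist ((Expr.read Arr.term (.reg Reg.u)).eval τ)
        ((Expr.const 0).eval τ)).arr Arr.dist = Function.update (τ.arr Arr.dist) src 0 := by
      simp [hu]
    rw [hD]
    refine ⟨fun w hw => ?_, fun w hw hk => ?_, fun ℓ hℓ w hh => ?_, fun _ h => by omega⟩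
    · rw [Function.update_apply]
      split_ifs
      · omega
      · exact (h w hw).le
    · rw [Function.update_apply] at hk ⊢
      split_ifs at hk ⊢ with hws
      · exact hops_zero.2 hws.symm
      · have := h w hw
        omega
    · obtain rfl : ℓ = 0 := by omega
      rw [hops_zero.1 hh]
      simp

theorem distances_spec {B src : ℕ} {R : Raw} {σ : Store} (hR : Ready R σ) (hv : R.Valid)
    (hrel : RelNumbered R σ) (hn : R.n ≤ B) (hm : R.E.length ≤ B) (hk : R.k ≤ B)
    (hsrc : σ.arr Arr.term (σ.reg Reg.u) = src) :
    Ends B distances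
      (fun τ => ∀ w < R.n, τ.arr Arr.dist w = cappedDist R.Free R.k src w) σ := by
  refine .seq <| (initDist_spec hR hn hsrc).mono fun τ₁ hf₁ h₁ => ?_
  have hR₁ := hR.frame hf₁
  have hrel₁ := hrel.frame hf₁
  refine .upto (fun r τ => DistInv R src r 0 (τ.arr Arr.dist)) hR₁.k hk (fun _ _ _ h => h) h₁
    (fun r _ τ₂ hf₂ _ h₂ => ?_) (fun τ₂ _ h₂ w hw => h₂.eq hw)
  have hR₂ := hR₁.frame hf₂
  have hrel₂ := hrel₁.frame hf₂
  refine .upto (fun i τ => DistInv R src r i (τ.arr Arr.dist)) hR₂.m hm (fun _ _ _ h => h) h₂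
    (fun i hi τ₃ hf₃ hi₃ h₃ => ?_) (fun τ₃ _ h₃ => h₃.next)
  have hR₃ := hR₂.frame hf₃
  have hidx := (hrel₂.frame hf₃).idx i
  refine .ite (fun he => .skip ?_) fun he => ?_
  · simp only [Expr.eval, hi₃, hidx] at he
    refine h₃.skip ?_
    by_contra hn
    simp [hn] at he
  · have hnot : i ∉ R.rel := by
      intro hmem
      simp only [Expr.eval, hi₃, hidx, if_pos hmem] at he
      omega
    refine .seq <| (load_spec hR₃.E hi₃ hi fun v => rfl).mono fun τ₄ hf₄ ⟨ha, hb⟩ => ?_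
    refine .seq <| relax_spec.mono fun τ₅ hf₅ h₅ => relax_spec.mono fun τ₆ hf₆ h₆ => ?_
    rw [h₆, h₅, hf₅.reg _ (by decide), hf₅.reg _ (by decide), hf₄.arr _ (by decide), ha, hb]
    rw [List.getD_eq_getElem _ _ hi]
    have hmem := List.getElem_mem hi
    exact h₃.relaxed_both (List.getElem?_eq_getElem hi) hnot (hv.E.lt_left _ hmem)
      (hv.E.lt_right _ hmem)

/-! ### Writing the kernel -/

/-- Write the path for the pair `u, v`, of length `d`. -/
def emitPath : Prog :=
  .upto Reg.j Reg.d
    (.ite (.reg Reg.j) (.assign Reg.x (.add (.reg Reg.base) (.reg Reg.j)))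
        (.assign Reg.x (.reg Reg.u)) ;;
      .ite (.sub (.reg Reg.d) (.add (.reg Reg.j) (.const 1)))
        (.assign Reg.y (.add (.reg Reg.base) (.add (.reg Reg.j) (.const 1))))
        (.assign Reg.y (.reg Reg.v)) ;;
      emit Arr.output Reg.out Reg.x Reg.y)

/-- Write the paths for all pairs of terminals. -/
def emitConnectors : Prog :=
  .assign Reg.base (.reg Reg.term) ;;
  .upto Reg.u Reg.term
    (distances ;;
      .upto Reg.v Reg.term
        (.assign Reg.d (.read Arr.dist (.read Arr.term (.reg Reg.v))) ;;
          .ite (.sub (.reg Reg.v) (.reg Reg.u))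
            (.ite (.sub (.add (.reg Reg.k) (.const 1)) (.reg Reg.d)) emitPath .skip) .skip ;;
          .assign Reg.base (.add (.reg Reg.base) (.reg Reg.k))))

/-- Write the surviving forcing edges, and the header. -/
def finish : Prog :=
  .assign Reg.edges (.reg Reg.out) ;;
  .upto Reg.i Reg.kept
    (load Arr.kept (.const 6) Reg.i Reg.a Reg.b ;;
      .assign Reg.x (.sub (.read Arr.relIdx (.reg Reg.a)) (.const 1)) ;;
      .assign Reg.y (.sub (.read Arr.relIdx (.reg Reg.b)) (.const 1)) ;;
      emit Arr.output Reg.out Reg.x Reg.y) ;;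
  .write Arr.output (.const 0) (.reg Reg.base) ;;
  .write Arr.output (.const 1) (.reg Reg.edges) ;;
  .write Arr.output (.const 2) (.reg Reg.kept) ;;
  .write Arr.output (.const 3) (.const 0) ;;
  .write Arr.output (.const 4) (.const 1) ;;
  .write Arr.output (.const 5) (.reg Reg.k)

/-- The list of pairs in the output is `L`. -/
def Output (L : List (ℕ × ℕ)) (σ : Store) : Prop :=
  PairsAt (σ.arr Arr.output) 6 (σ.reg Reg.out) L

theorem Output.frame {L : List (ℕ × ℕ)} {p : Prog} {σ τ : Store} (h : Output L σ)
    (hf : Frame p σ τ) (hd : Arr.output ∉ p.warrs ∧ Reg.out ∉ p.wregs := by decide) :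
    Output L τ := by
  rw [Output, hf.arr _ hd.1, hf.reg _ hd.2]
  exact h

theorem emitPath_spec {B u v b d : ℕ} {σ : Store} {L : List (ℕ × ℕ)} (h : Output L σ)
    (hu : σ.reg Reg.u = u) (hv : σ.reg Reg.v = v) (hb : σ.reg Reg.base = b)
    (hd : σ.reg Reg.d = d) (hB : d ≤ B) :
    Ends B emitPath (Output (L ++ pathPairs u v b d)) σ := by
  refine .upto (fun j => Output (L ++ (List.range j).map fun j =>
      (pathVertex u v b d j, pathVertex u v b d (j + 1)))) hd hB (fun _ _ _ h => h)
    (by simpa using h) (fun j hj τ hf hjτ h => ?_) (fun τ _ h => h)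
  have hu' : τ.reg Reg.u = u := by rw [hf.reg _ (by decide), hu]
  have hv' : τ.reg Reg.v = v := by rw [hf.reg _ (by decide), hv]
  have hb' : τ.reg Reg.base = b := by rw [hf.reg _ (by decide), hb]
  have hd' : τ.reg Reg.d = d := by rw [hf.reg _ (by decide), hd]
  have hx : Ends B (.ite (.reg Reg.j) (.assign Reg.x (.add (.reg Reg.base) (.reg Reg.j)))
        (.assign Reg.x (.reg Reg.u))) (fun υ => υ.reg Reg.x = pathVertex u v b d j) τ := by
    refine .ite (fun he => .assign ?_) fun he => .assign ?_ <;>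
    simp only [Expr.eval, hjτ] at he
    · simp [hb', hjτ, pathVertex, he, hj.ne]
    · simp [hu', pathVertex, he]
  refine .seq <| hx.mono fun τ₁ hf₁ h₁ => ?_
  have hy : Ends B (.ite (.sub (.reg Reg.d) (.add (.reg Reg.j) (.const 1)))
        (.assign Reg.y (.add (.reg Reg.base) (.add (.reg Reg.j) (.const 1))))
        (.assign Reg.y (.reg Reg.v))) (fun υ => υ.reg Reg.y = pathVertex u v b d (j + 1)) τ₁ := by
    have hj₁ : τ₁.reg Reg.j = j := by rw [hf₁.reg _ (by decide), hjτ]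
    have hd₁ : τ₁.reg Reg.d = d := by rw [hf₁.reg _ (by decide), hd']
    have hb₁ : τ₁.reg Reg.base = b := by rw [hf₁.reg _ (by decide), hb']
    have hv₁ : τ₁.reg Reg.v = v := by rw [hf₁.reg _ (by decide), hv']
    refine .ite (fun he => .assign ?_) fun he => .assign ?_ <;>
    simp only [Expr.eval, hj₁, hd₁] at he
    · have : j + 1 ≠ d := by omega
      simp [hb₁, hj₁, pathVertex, this]
    · have : j + 1 = d := by omega
      have hd0 : d ≠ 0 := by omega
      simp [hv₁, pathVertex, this, hd0]
  refine .seq <| hy.mono fun τ₂ hf₂ h₂ => ?_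
  refine (emit_spec ((h.frame hf₁).frame hf₂)).mono fun τ₃ hf₃ h₃ => ?_
  rw [h₂, hf₂.reg _ (by decide), h₁] at h₃
  rw [List.range_succ, List.map_append, ← List.append_assoc]
  exact h₃

theorem emitConnectors_spec {B : ℕ} {R : Raw} {σ : Store} (hR : Ready R σ) (hv : R.Valid)
    (hrel : RelNumbered R σ) (hterm : TermNumbered R.term σ) (hout : Output R.relPairs σ)
    (hn : R.n ≤ B) (hm : R.E.length ≤ B) (hk : R.k ≤ B) :
    Ends B emitConnectors (fun τ => Output R.kernel.E τ ∧ τ.reg Reg.base = R.kernel.n) σ := by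
  have hq : R.term.length ≤ B :=
    (length_number_le_of_lt fun v hv' => hv.term_lt hv').trans hn
  set path : ℕ → ℕ → List (ℕ × ℕ) := fun u v => if u < v ∧ R.termDist u v ≤ R.k then
    pathPairs u v (block R.term.length R.k u v) (R.termDist u v) else [] with hpath
  refine .seq <| .assign ?_
  have hlen := hterm.len
  refine .upto (fun u τ => Output (R.relPairs ++ (List.range u).flatMap fun u =>
      (List.range R.term.length).flatMap (path u)) τ ∧
      τ.reg Reg.base = block R.term.length R.k u 0) (by simpa using hlen) hq
    (fun _ _ _ h => h) ⟨by simpa [Output] using hout, by simpa [block] using hlen⟩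
    (fun u hu τ hf huτ ⟨h, hb⟩ => ?_) (fun τ hf ⟨h, hb⟩ => ⟨h, ?_⟩)
  · have hf₀ : ∀ x v, Frame (.assign x v) σ (σ.setReg x (v.eval σ)) := fun x v =>
      (Run.assign σ x v).frame
    have hR₁ := (hR.frame (hf₀ _ _)).frame hf
    have hrel₁ := (hrel.frame (hf₀ _ _)).frame hf
    have hterm₁ := (hterm.frame (hf₀ _ _)).frame hf
    refine .seq <| (distances_spec hR₁ hv hrel₁ hn hm hk (src := R.term.getD u 0)
      (by rw [huτ, hterm₁.get u hu])).mono fun τ₂ hf₂ hdist => ?_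
    have hR₂ := hR₁.frame hf₂
    have hterm₂ := hterm₁.frame hf₂
    have hb₂ : τ₂.reg Reg.base = block R.term.length R.k u 0 := by
      rw [hf₂.reg _ (by decide), hb]
    have hu₂ : τ₂.reg Reg.u = u := by rw [hf₂.reg _ (by decide), huτ]
    refine .upto (fun v τ => Output ((R.relPairs ++ (List.range u).flatMap fun u =>
        (List.range R.term.length).flatMap (path u)) ++ (List.range v).flatMap (path u)) τ ∧
        τ.reg Reg.base = block R.term.length R.k u v) hterm₂.len hq (fun _ _ _ h => h)
      ⟨by simpa [Output] using h.frame hf₂, hb₂⟩ (fun v hvq τ₃ hf₃ hv₃ ⟨h₃, hb₃⟩ => ?_)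
      (fun τ₃ hf₃ ⟨h₃, hb₃⟩ => ⟨?_, ?_⟩)
    · have hR₃ := hR₂.frame hf₃
      have hterm₃ := hterm₂.frame hf₃
      have hu₃ : τ₃.reg Reg.u = u := by rw [hf₃.reg _ (by decide), hu₂]
      have hd : (Expr.read Arr.dist (.read Arr.term (.reg Reg.v))).eval τ₃ = R.termDist u v := by
        have hlt : R.term.getD v 0 < R.n := hv.term_lt (mem_number.1 (getD_mem hvq))
        simp only [Expr.eval]
        rw [hv₃, hterm₃.get v hvq, hf₃.arr Arr.dist (by decide), hdist _ hlt, Raw.termDist]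
      refine .seq <| .assign ?_
      rw [hd]
      have key : Ends B (.ite (.sub (.reg Reg.v) (.reg Reg.u))
          (.ite (.sub (.add (.reg Reg.k) (.const 1)) (.reg Reg.d)) emitPath .skip) .skip)
          (Output (((R.relPairs ++ (List.range u).flatMap fun u =>
            (List.range R.term.length).flatMap (path u)) ++ (List.range v).flatMap (path u)) ++
            path u v)) (τ₃.setReg Reg.d (R.termDist u v)) := by
        refine .ite (fun h1 => .ite (fun h2 => ?_) fun h2 => .skip ?_) fun h1 => .skip ?_
        · simp [hu₃, hv₃, hR₃.k] at h1 h2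
          rw [hpath]
          dsimp only
          rw [if_pos ⟨by omega, by omega⟩]
          exact emitPath_spec h₃ (by simpa using hu₃) (by simpa using hv₃) (by simpa using hb₃)
            (by simp) (by omega)
        · simp [hR₃.k] at h2
          rw [hpath]
          dsimp only
          rw [if_neg (by omega), List.append_nil]
          exact h₃
        · simp [hu₃, hv₃] at h1
          rw [hpath]
          dsimp only
          rw [if_neg (by omega), List.append_nil]
          exact h₃
      refine .seq <| key.mono fun τ₄ hf₄ h₄ => .assign ⟨?_, ?_⟩
      · rw [List.range_succ, List.flatMap_append, List.flatMap_singleton, ← List.append_assoc]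
        exact h₄
      · have hk₄ : τ₄.reg Reg.k = R.k := by
          rw [hf₄.reg _ (by decide)]
          simpa using hR₃.k
        have hb₄ : τ₄.reg Reg.base = block R.term.length R.k u v := by
          rw [hf₄.reg _ (by decide)]
          simpa using hb₃
        simp [hk₄, hb₄, block]
        ring
    · rw [List.range_succ, List.flatMap_append, List.flatMap_singleton, ← List.append_assoc]
      exact h₃
    · rw [hb₃, block, block]
      ring
  · rw [hb, block, Raw.kernel]
    ring

/-- The lists of pairs are contiguous in the word of an instance, so that they can be written as one
list behind the header. -/
theorem word_of_pairsAt {A : ℕ → ℕ} {c : ℕ} {R : Raw} (h : PairsAt A 6 c (R.E ++ R.F))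
    (h0 : A 0 = R.n) (h1 : A 1 = R.E.length) (h2 : A 2 = R.F.length) (h3 : A 3 = R.s)
    (h4 : A 4 = R.t) (h5 : A 5 = R.k) (i : Fin R.word.length) : A i = R.word.get i := by
  obtain ⟨i, hi⟩ := i
  have hw : R.word = [R.n, R.E.length, R.F.length, R.s, R.t, R.k] ++ flat (R.E ++ R.F) := by
    rw [flat_append, Raw.word, List.append_assoc]
  have hlen : R.word.length = 6 + 2 * (R.E ++ R.F).length := by
    rw [hw, List.length_append, length_flat]
    rfl
  rw [List.get_eq_getElem, ← List.getD_eq_getElem _ 0 hi]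
  change A i = R.word.getD i 0
  by_cases h6 : i < 6
  · rw [hw, List.getD_append _ _ _ _ (by simpa using h6)]
    interval_cases i <;> simp [*]
  · rw [hw, List.getD_append_right _ _ _ _ (by simp; omega)]
    rw [hlen] at hi
    have hmod := Nat.mod_two_eq_zero_or_one (i - 6)
    set j := (i - 6) / 2 with hj
    rcases hmod with hm | hm
    · have hij : i = 6 + 2 * j := by omega
      rw [hij, h.fst j (by omega), ← (getD_flat _ j).1]
      congr 1
      simp
    · have hij : i = 6 + 2 * j + 1 := by omega
      rw [hij, h.snd j (by omega), ← (getD_flat _ j).2]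
      congr 1
      simp
      omega

theorem finish_spec {B : ℕ} {R : Raw} {σ : Store} (hR : Ready R σ) (hrel : RelNumbered R σ)
    (hB : R.F.length ≤ B) (hkept : PairsAt (σ.arr Arr.kept) 6 (σ.reg Reg.kept) R.keptPairs)
    (hout : Output R.kernel.E σ) (hbase : σ.reg Reg.base = R.kernel.n) :
    Ends B finish (fun τ => ∀ i : Fin R.kernel.word.length,
      τ.arr Arr.output i = R.kernel.word.get i) σ := by
  have hkB : R.keptPairs.length ≤ B := (kept_sublist _ _).length_le.trans hB
  refine .seq <| .assign ?_
  have hf₀ : Frame (.assign Reg.edges (.reg Reg.out)) σ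
      (σ.setReg Reg.edges ((Expr.reg Reg.out).eval σ)) := (Run.assign σ _ _).frame
  have hR₁ := hR.frame hf₀
  have hrel₁ := hrel.frame hf₀
  have hout₁ := hout.frame hf₀
  have hbase₁ : (σ.setReg Reg.edges ((Expr.reg Reg.out).eval σ)).reg Reg.base = R.kernel.n := by
    simpa using hbase
  have hedges₁ : (σ.setReg Reg.edges ((Expr.reg Reg.out).eval σ)).reg Reg.edges =
      R.kernel.E.length := by simpa using hout.len
  have hkept₁ : PairsAt ((σ.setReg Reg.edges ((Expr.reg Reg.out).eval σ)).arr Arr.kept) 6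
      ((σ.setReg Reg.edges ((Expr.reg Reg.out).eval σ)).reg Reg.kept) R.keptPairs := by
    simpa using hkept
  generalize σ.setReg Reg.edges ((Expr.reg Reg.out).eval σ) = σ at *
  refine .seq <| .upto (fun i => Output (R.kernel.E ++ R.kernel.F.take i)) hkept₁.len hkB
    (fun _ _ _ h => h) (by simpa using hout₁) (fun i hi τ hf hiτ h => ?_) (fun τ hf h => ?_)
  · have hk : PairsAt (τ.arr Arr.kept) 6 (τ.reg Reg.kept) R.keptPairs := by
      rw [hf.arr _ (by decide), hf.reg _ (by decide)]
      exact hkept₁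
    refine .seq <| (load_spec hk hiτ hi fun v => rfl).mono fun τ₁ hf₁ ⟨ha, hb⟩ => ?_
    rw [List.getD_eq_getElem _ _ hi] at ha hb
    have hmem := R.mem_rel_of_mem (List.getElem_mem hi)
    have hidx := ((hrel₁.frame hf).frame hf₁).idx
    have hx := hidx R.keptPairs[i].1
    have hy := hidx R.keptPairs[i].2
    rw [if_pos hmem.1] at hx
    rw [if_pos hmem.2] at hy
    have hi' : i < R.kernel.F.length := by simpa [Raw.kernel] using hi
    refine .seq <| .assign <| .seq <| .assign <|
      (emit_spec (L := R.kernel.E ++ R.kernel.F.take i) ?_).mono fun τ₂ hf₂ h₂ => ?_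
    · simpa [Output] using h.frame hf₁
    · rw [List.take_succ_eq_append_getElem hi', ← List.append_assoc]
      have hF : R.kernel.F[i] =
          (R.rel.idxOf R.keptPairs[i].1, R.rel.idxOf R.keptPairs[i].2) := by
        simp [Raw.kernel]
      rw [hF]
      simpa [Output, ha, hb, hx, hy] using h₂
  · have hbase₂ : τ.reg Reg.base = R.kernel.n := by rw [hf.reg _ (by decide), hbase₁]
    have hedges₂ : τ.reg Reg.edges = R.kernel.E.length := by rw [hf.reg _ (by decide), hedges₁]
    have hkept₂ : τ.reg Reg.kept = R.kernel.F.length := by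
      rw [hf.reg _ (by decide), hkept₁.len]
      simp [Raw.kernel]
    have hk₂ : τ.reg Reg.k = R.kernel.k := (hR₁.frame hf).k
    have hlen : R.keptPairs.length = R.kernel.F.length := by simp [Raw.kernel]
    rw [hlen, List.take_length] at h
    refine .seq <| .write <| .seq <| .write <| .seq <| .write <| .seq <| .write <| .seq <|
      .write <| .write ?_
    apply word_of_pairsAt (c := τ.reg Reg.out)
    · refine ⟨h.len, fun j hj => ?_, fun j hj => ?_⟩
      · rw [← h.fst j hj]
        simp only [Store.arr_setArr, Expr.eval, if_true]
        iterate 6 rw [Function.update_of_ne (by omega)]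
      · rw [← h.snd j hj]
        simp only [Store.arr_setArr, Expr.eval, if_true]
        iterate 6 rw [Function.update_of_ne (by omega)]
    · simp [hbase₂]
    · simp [hedges₂]
    · simp [hkept₂]
    · simp [Raw.kernel]
    · simp [Raw.kernel]
    · simp [hk₂]

/-! ### The kernelization -/

/-- The kernelization algorithm. -/
def kernelize : Prog :=
  readInstance ;; selectPairs ;; numberTerms ;; emitRel ;; emitConnectors ;; finish

theorem kernelize_spec {B : ℕ} {R : Raw} (hv : R.Valid)
    (hB : R.n + R.E.length + R.F.length + 1 ≤ B) :
    Ends B kernelize (fun τ => ∀ i : Fin R.capped.kernel.word.length,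
      τ.arr Arr.output i = R.capped.kernel.word.get i) (Store.init R.word) := by
  have hv' : R.capped.Valid :=
    ⟨hv.E, hv.F, hv.s_lt, hv.t_lt, hv.s_ne_t, lt_min hv.k_pos (by omega)⟩
  have hn : R.capped.n ≤ B := by change R.n ≤ B; omega
  have hm : R.capped.E.length ≤ B := by change R.E.length ≤ B; omega
  have hp : R.capped.F.length ≤ B := by change R.F.length ≤ B; omega
  have hk : R.capped.k ≤ B := (min_le_right _ _).trans (by omega)
  refine .seq <| (readInstance_spec R (by omega)).mono fun τ₁ hf₁ ⟨hR₁, hlim⟩ => ?_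
  have harr : ∀ a, a ≠ 0 → ∀ i, τ₁.arr a i = 0 := by
    intro a ha i
    rw [hf₁.arr a (by simp [readInstance, Prog.upto, Prog.warrs])]
    simp [Store.init, ha]
  have hreg : ∀ x, x ∉ readInstance.wregs → τ₁.reg x = 0 := fun x hx => hf₁.reg x hx
  generalize R.capped = R at *
  have hrelB : R.rel.length ≤ B :=
    (length_number_le_of_lt fun v h => hv'.rel_lt (mem_number.2 h)).trans hm
  have hsel₁ : Selected [] τ₁ := by
    refine ⟨fun a => ?_, .nil (hreg _ (by decide)), .nil (harr _ (by decide))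
      (hreg _ (by decide))⟩
    rw [harr _ (by decide)]
    rfl
  refine .seq <| (selectPairs_spec hR₁ hv' hp hlim hsel₁).mono fun τ₂ hf₂ hsel₂ => ?_
  have hR₂ := hR₁.frame hf₂
  have hrel₂ : RelNumbered R τ₂ := hsel₂.rel
  have hterm₂ : TermNumbered [] τ₂ := by
    refine .nil (fun v => ?_) ?_
    · rw [hf₂.arr _ (by decide), harr _ (by decide)]
    · rw [hf₂.reg _ (by decide), hreg _ (by decide)]
  refine .seq <| (numberTerms_spec hR₂ hv' hrelB hrel₂ hterm₂).mono fun τ₃ hf₃ hterm₃ => ?_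
  have hR₃ := hR₂.frame hf₃
  have hrel₃ := hrel₂.frame hf₃
  have hout₃ : τ₃.reg Reg.out = 0 := by
    rw [hf₃.reg _ (by decide), hf₂.reg _ (by decide), hreg _ (by decide)]
  refine .seq <| (emitRel_spec hR₃ hv' hrelB hrel₃ hterm₃ hout₃).mono fun τ₄ hf₄ hout₄ => ?_
  have hR₄ := hR₃.frame hf₄
  have hrel₄ := hrel₃.frame hf₄
  refine .seq <| (emitConnectors_spec hR₄ hv' hrel₄ (hterm₃.frame hf₄) hout₄ hn hm hk).mono
    fun τ₅ hf₅ ⟨hout₅, hbase⟩ => ?_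
  refine finish_spec (hR₄.frame hf₅) (hrel₄.frame hf₅) hp ?_ hout₅ hbase
  rw [hf₅.arr _ (by decide), hf₅.reg _ (by decide), hf₄.arr _ (by decide), hf₄.reg _ (by decide),
    hf₃.arr _ (by decide), hf₃.reg _ (by decide)]
  exact hsel₂.pairs

end SPFG

/-- Shortest Path with Forcing Graph, parameterized by the solution size `k`, admits a polynomial
kernel with `O(k ^ 5)` vertices and edges. -/
theorem theorem3 :
    ∃ (Q : RAM.Prog) (time size : Polynomial ℕ) (C : ℕ),
      SPFG.IsKernelization Q (fun N => time.eval N) (fun k => size.eval k)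
        (fun k => C * k ^ 5) (fun k => C * k ^ 5) := by
  -- no loop runs more than `|I| + 1` times; `500 ≥ 210 + 210 + 3 + 1 + 1` bounds the size
  refine ⟨SPFG.kernelize, SPFG.kernelize.timePoly.comp (.X + 1), .C 500 * .X ^ 5, 210, ?_⟩
  rintro I w ⟨P, rfl⟩
  have hv := P.raw_valid
  have hv' : P.raw.capped.Valid :=
    ⟨hv.E, hv.F, hv.s_lt, hv.t_lt, hv.s_ne_t, lt_min hv.k_pos (by omega)⟩
  obtain ⟨I', P', hP'⟩ := hv'.kernel.exists_presentation
  have hword := P'.raw_word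
  have hn : I'.n = P.raw.capped.kernel.n := congrArg SPFG.Raw.n hP'
  have hk : I'.k = P.raw.capped.k := congrArg SPFG.Raw.k hP'
  have hE : I'.numEdges = P.raw.capped.kernel.E.length := by
    rw [P'.numEdges_eq, ← hP']
    simp [SPFG.Instance.Presentation.raw]
  have hF : I'.numForcing = P.raw.capped.kernel.F.length := by
    rw [P'.numForcing_eq, ← hP']
    simp [SPFG.Instance.Presentation.raw]
  obtain ⟨b1, b2, b3⟩ := SPFG.Raw.kernel_bounds hv'.k_pos
  have hle : P.raw.capped.k ≤ I.k := min_le_left _ _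
  have hle5 : P.raw.capped.k ^ 5 ≤ I.k ^ 5 := Nat.pow_le_pow_left hle 5
  refine ⟨I', P'.word, ⟨P', rfl⟩, ?_, ?_, ?_, ?_, ?_⟩
  · obtain ⟨T, τ, hT, hr, hτ⟩ := SPFG.kernelize_spec (B := I.size + 1) hv (by
      have h1 : P.raw.E.length = I.numEdges := by
        rw [P.numEdges_eq]; simp [SPFG.Instance.Presentation.raw]
      have h2 : P.raw.F.length = I.numForcing := by
        rw [P.numForcing_eq]; simp [SPFG.Instance.Presentation.raw]
      have h3 : P.raw.n = I.n := rfl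
      rw [SPFG.Instance.size]
      omega)
    rw [P.raw_word] at hr
    rw [← hP', hword] at hτ
    exact ⟨T, τ, by simpa using hT, hr, hτ⟩
  · rw [← P'.isYes_raw_iff, hP', hv'.isYes_kernel_iff, ← P.isYes_raw_iff]
    exact (P.raw.isYes_cap hv.F).symm
  · have hs : Nat.size I'.k ≤ I'.k := by
      rw [Nat.size_le]
      exact Nat.lt_two_pow_self
    have h5 : P.raw.capped.k ≤ P.raw.capped.k ^ 5 := Nat.le_self_pow (by norm_num) _
    simp only [SPFG.Instance.size, Polynomial.eval_mul, Polynomial.eval_C, Polynomial.eval_pow,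
      Polynomial.eval_X]
    omega
  · simp only
    omega
  · simp only
    omega
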